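/- **Lemma (Two-sided Inheritance Lemma).** Conventions: for a graph $F$ and finite disjoint vertex sets $U,W$, let $e_F(U,W)$ be the number of edges of $F$ between $U$ and $W$, and for $p>0$ let $d_{p}(U,W)=\frac{e_F(U,W)}{p|U||W|}$ be the $p$-density of $(U,W)$ in $F$ (read as $0$ if $U$ or $W$ is empty). The pair $(U,W)$ is $(p,\gamma)$-*bijumbled* in $F$ if $\big|e_F(U',W')-p|U'||W'|\big|\le\gamma\sqrt{|U'||W'|}$ for all $U'\subseteq U$, $W'\subseteq W$. It is $(\varepsilon,d,p)$-*regular* in $F$ if $|d_p(U',W')-d_p(U,W)|\le\varepsilon$ for all $U'\subseteq U$, $W'\subseteq W$ with $|U'|\ge\varepsilon|U|$ and $|W'|\ge\varepsilon|W|$, and moreover $d_p(U,W)\ge d-\varepsilon$. The neighbourhood of $x$ in $F$ is $N_F(x)$. For all $\varepsilon',d>0$ there are $\varepsilon,c>0$ such that for all $0<p<1$ the following holds. Let $G\subseteq\Gamma$ be graphs and let $X,Y,Z$ be finite, pairwise disjoint sets of vertices of $\Gamma$. Assume that - $(X,Y)$ is $\big(p,\,c\,p^{2}\sqrt{|X||Y|}\big)$-bijumbled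 in $\Gamma$, - $(X,Z)$ is $\big(p,\,c\,p^{3}\sqrt{|X||Z|}\big)$-bijumbled in $\Gamma$, - $(Y,Z)$ is $\big(p,\,c\,p^{5/2}(\log_2\tfrac1p)^{-1/2}\sqrt{|Y||Z|}\big)$-bijumbled in $\Gamma$, and - $(Y,Z)$ is $(\varepsilon,d,p)$-regular in $G$. Then for all but at most $\varepsilon'|X|$ vertices $x\in X$, the pair $\big(N_\Gamma(x)\cap Y,\;N_\Gamma(x)\cap Z\big)$ is $(\varepsilon',d,p)$-regular in $G$. -/

import Mathlib

open Classical in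
/-- `e_G(U, W)`: the number of edges of `G` between the disjoint finite vertex sets `U` and `W`,
counted as pairs `(u, w)` in `U × W` with `u` adjacent to `w`. -/
noncomputable def edgesBetween {V : Type*} (G : SimpleGraph V) (U W : Finset V) : ℕ :=
  (G.interedges U W).card

/-- The `p`-density `d_p(U, W) = e(U, W) / (p |U| |W|)` (equal to `0` if `U` or `W` is empty). -/
noncomputable def pDensity {V : Type*} (G : SimpleGraph V) (p : ℝ) (U W : Finset V) : ℝ :=
  (edgesBetween G U W : ℝ) / (p * (U.card : ℝ) * (W.card : ℝ))

/-- The pair `(U, W)` of disjoint sets is `(ε, p)`-regular in `G`. -/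
def IsSparseRegular {V : Type*} (G : SimpleGraph V) (ε p : ℝ) (U W : Finset V) : Prop :=
  ∀ U' ⊆ U, ∀ W' ⊆ W, ε * (U.card : ℝ) ≤ (U'.card : ℝ) → ε * (W.card : ℝ) ≤ (W'.card : ℝ) →
    |pDensity G p U' W' - pDensity G p U W| ≤ ε

/-- The pair `(U, W)` of disjoint sets is `(ε, d, p)`-regular in `G`: it is `(ε, p)`-regular
and its `p`-density is at least `d - ε`. -/
def IsSparseRegularWith {V : Type*} (G : SimpleGraph V) (ε d p : ℝ) (U W : Finset V) : Prop :=
  IsSparseRegular G ε p U W ∧ d - ε ≤ pDensity G p U W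

/-- The pair `(U, W)` of disjoint sets is `(p, γ)`-bijumbled in `Γ`. -/
def IsBijumbled {V : Type*} (Γ : SimpleGraph V) (p γ : ℝ) (U W : Finset V) : Prop :=
  ∀ U' ⊆ U, ∀ W' ⊆ W,
    |(edgesBetween Γ U' W' : ℝ) - p * (U'.card : ℝ) * (W'.card : ℝ)| ≤
      γ * Real.sqrt ((U'.card : ℝ) * (W'.card : ℝ))

open Classical in
/-- `N_Γ(x) ∩ Y`. -/
noncomputable def nbrIn {V : Type*} (Γ : SimpleGraph V) (x : V) (Y : Finset V) : Finset V :=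
  Y.filter (fun y => Γ.Adj x y)

/-! Write n = |Y|, m = |Z|, and let q be the p-density of (Y, Z) in G. Fix x, let a and b be the
indicators of its neighbourhoods in Y and Z, and let u ≤ a, w ≤ b be indicators of test sets. By
Cauchy–Schwarz, the discrepancy Σ u(y) w(z) (G(y,z) - qp) is controlled by Σ_z b(z) D(z)², where
D(z) = Σ_y u(y) (G(y,z) - qp). Expanding the square shows that it is small once, on average inside
the neighbourhoods of x, codegrees of G are not too large and degrees are not too small
(`sq_sum_mul_sub_le`). These conditions do not mention u or w, so they can be averaged over x, and
Markov's inequality leaves few exceptional vertices.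

The averages rest on three facts. Passing from codegrees in Z to codegrees in the neighbourhood of x
uses the bijumbledness of (X, Z) on common neighbourhoods of pairs y, y' (`sum_sum_abs_codeg_le`).
Passing from all pairs y, y' to pairs in the neighbourhood of x uses that codegrees into X are close
to p²|X|, even when weighted by codegrees of Γ into Z (`sum_abs_codeg_sub_mul_codeg_le`). Finally,
the total excess of codegrees of G over q²p²m is o(p²n²m) (`sum_indicator_mul_codeg_sub_le`); this
is a four-cycle count in G in which one edge of Γ is replaced by the constant p.

For (Y, Z) an error c p² suffices in this argument, and the assumed bound implies it when p ≤ 1/2.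
For p > 1/2 the logarithm may make that assumption empty, but then neighbourhoods have linear size
and regularity passes to them directly. -/

/-! ### Indicator functions and splitting by signs. -/

/-- `u` takes only the values `0` and `1`. -/
def IsIndicator {α : Type*} (u : α → ℝ) : Prop := ∀ x, u x = 0 ∨ u x = 1

namespace IsIndicator

variable {α : Type*} {u v : α → ℝ}

lemma nonneg (hu : IsIndicator u) (x : α) : 0 ≤ u x := by
  rcases hu x with h | h <;> simp [h]

lemma le_one (hu : IsIndicator u) (x : α) : u x ≤ 1 := by
  rcases hu x with h | h <;> simp [h]

lemma sq_eq (hu : IsIndicator u) (x : α) : u x * u x = u x := by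
  rcases hu x with h | h <;> simp [h]

lemma mul (hu : IsIndicator u) (hv : IsIndicator v) : IsIndicator fun x => u x * v x := by
  intro x
  rcases hu x with h | h <;> rcases hv x with h' | h' <;> simp [h, h']

lemma one : IsIndicator fun _ : α => (1 : ℝ) := fun _ => Or.inr rfl

lemma ite (P : α → Prop) [DecidablePred P] : IsIndicator fun x => if P x then (1 : ℝ) else 0 := by
  intro x
  by_cases h : P x <;> simp [h]

lemma sum_nonneg (hu : IsIndicator u) (X : Finset α) : 0 ≤ ∑ x ∈ X, u x :=
  Finset.sum_nonneg fun x _ => hu.nonneg x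

lemma sum_le_card (hu : IsIndicator u) (X : Finset α) : ∑ x ∈ X, u x ≤ X.card := by
  simpa using Finset.sum_le_sum fun x (_ : x ∈ X) => hu.le_one x

end IsIndicator

/-- An `ℓ¹` bound from bounds on all partial sums, by splitting according to signs. -/
lemma sum_mul_abs_le_two_mul {α : Type*} (X : Finset α) {u f : α → ℝ} {M : ℝ}
    (hu : IsIndicator u)
    (h : ∀ v : α → ℝ, IsIndicator v → (∀ x, v x ≤ u x) → |∑ x ∈ X, v x * f x| ≤ M) :
    ∑ x ∈ X, u x * |f x| ≤ 2 * M := by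
  classical
  have h1 := h _ (hu.mul (IsIndicator.ite fun x => 0 ≤ f x)) (fun x => by
    split_ifs <;> simp [hu.nonneg x])
  have h2 := h _ (hu.mul (IsIndicator.ite fun x => f x < 0)) (fun x => by
    split_ifs <;> simp [hu.nonneg x])
  have e : ∑ x ∈ X, u x * |f x| =
      ∑ x ∈ X, u x * (if 0 ≤ f x then 1 else 0) * f x -
        ∑ x ∈ X, u x * (if f x < 0 then 1 else 0) * f x := by
    rw [← Finset.sum_sub_distrib]
    refine Finset.sum_congr rfl fun x _ => ?_
    by_cases hx : 0 ≤ f x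
    · simp [hx, not_lt.2 hx, abs_of_nonneg hx]
    · simp [hx, not_le.1 hx, abs_of_neg (not_le.1 hx)]
  rw [e]
  linarith [(abs_le.1 h1).2, (abs_le.1 h2).1]

lemma sum_sum_sum_mul_eq {β γ : Type*} (Y : Finset β) (Z : Finset γ) (f : β → γ → ℝ) :
    ∑ y ∈ Y, ∑ y' ∈ Y, ∑ z ∈ Z, f y z * f y' z =
      ∑ z ∈ Z, (∑ y ∈ Y, f y z) * ∑ y ∈ Y, f y z := by
  simp only [Finset.sum_mul_sum]
  rw [Finset.sum_comm (s := Z)]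
  exact Finset.sum_congr rfl fun y _ => Finset.sum_comm

/-! ### Jumbled kernels: error bounds linear in the sizes of the test sets. -/

/-- Bijumbledness of a kernel `A` on `X × Y` with normalised error `κ`, in the form which
the inequality of arithmetic and geometric means gives. -/
def IsJumbledKernel {α β : Type*} (A : α → β → ℝ) (p κ : ℝ) (X : Finset α) (Y : Finset β) :
    Prop :=
  ∀ u v, IsIndicator u → IsIndicator v → ∀ t : ℝ, 0 < t →
    |∑ x ∈ X, ∑ y ∈ Y, u x * v y * (A x y - p)| ≤
      κ / 2 * (t * Y.card * ∑ x ∈ X, u x + X.card * (∑ y ∈ Y, v y) / t)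

namespace IsJumbledKernel

variable {α β γ : Type*} {A : α → β → ℝ} {p κ : ℝ} {X : Finset α} {Y : Finset β}

lemma swap (h : IsJumbledKernel A p κ X Y) : IsJumbledKernel (fun y x => A x y) p κ Y X := by
  intro u v hu hv t ht
  have := h v u hv hu t⁻¹ (inv_pos.2 ht)
  rw [Finset.sum_comm]
  convert this using 1
  · congr 1
    refine Finset.sum_congr rfl fun x _ => Finset.sum_congr rfl fun y _ => by ring
  · field_simp
    ring

/-- The error bound is monotone in u, so restricting u to one sign of the inner sum does not
increase it; absolute values cost a factor two. Taking v to be a neighbourhood or a common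
neighbourhood gives bounds that are linear in degrees or codegrees and can be summed further. -/
lemma sum_mul_abs_le (h : IsJumbledKernel A p κ X Y) (hκ : 0 ≤ κ) {u : α → ℝ} {v : β → ℝ}
    (hu : IsIndicator u) (hv : IsIndicator v) :
    ∑ x ∈ X, u x * |∑ y ∈ Y, v y * (A x y - p)| ≤
      κ * (Y.card * ∑ x ∈ X, u x + X.card * ∑ y ∈ Y, v y) := by
  have := sum_mul_abs_le_two_mul X (f := fun x => ∑ y ∈ Y, v y * (A x y - p))
    (M := κ / 2 * (Y.card * ∑ x ∈ X, u x + X.card * ∑ y ∈ Y, v y)) hu ?_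
  · linarith
  intro w hw hwu
  have h1 := h w v hw hv 1 one_pos
  simp only [Finset.mul_sum, one_mul, div_one] at h1 ⊢
  simp only [← mul_assoc]
  refine h1.trans ?_
  simp only [← Finset.mul_sum]
  gcongr with x
  exact hwu x

lemma sum_abs_le (h : IsJumbledKernel A p κ X Y) (hκ : 0 ≤ κ) :
    ∑ x ∈ X, |∑ y ∈ Y, (A x y - p)| ≤ 2 * κ * X.card * Y.card := by
  have := h.sum_mul_abs_le hκ IsIndicator.one IsIndicator.one
  simp only [one_mul, Finset.sum_const, nsmul_eq_mul, mul_one] at this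
  linarith

lemma sum_le (h : IsJumbledKernel A p κ X Y) {u : α → ℝ} {v : β → ℝ}
    (hu : IsIndicator u) (hv : IsIndicator v) :
    ∑ x ∈ X, ∑ y ∈ Y, u x * v y * A x y ≤ p * (∑ x ∈ X, u x) * (∑ y ∈ Y, v y) +
      κ / 2 * (Y.card * ∑ x ∈ X, u x + X.card * ∑ y ∈ Y, v y) := by
  have h1 := (abs_le.1 (h u v hu hv 1 one_pos)).2
  have e : ∑ x ∈ X, ∑ y ∈ Y, u x * v y * (A x y - p) =
      ∑ x ∈ X, ∑ y ∈ Y, u x * v y * A x y - p * (∑ x ∈ X, u x) * (∑ y ∈ Y, v y) := by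
    rw [mul_assoc, Finset.sum_mul_sum, Finset.mul_sum, ← Finset.sum_sub_distrib]
    refine Finset.sum_congr rfl fun x _ => ?_
    rw [Finset.mul_sum, ← Finset.sum_sub_distrib]
    exact Finset.sum_congr rfl fun y _ => by ring
  rw [e] at h1
  simp only [one_mul, div_one] at h1
  linarith

lemma sum_sum_le (h : IsJumbledKernel A p κ X Y) (hκ : κ ≤ p) :
    ∑ x ∈ X, ∑ y ∈ Y, A x y ≤ 2 * p * X.card * Y.card := by
  have := h.sum_le IsIndicator.one IsIndicator.one
  simp only [one_mul, Finset.sum_const, nsmul_eq_mul, mul_one] at this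
  have h2 : κ * ((X.card : ℝ) * Y.card) ≤ p * ((X.card : ℝ) * Y.card) := by gcongr
  linarith

/-- An upper bound on the number of paths `x, y, z` where `xy` is an edge of a jumbled kernel and
`yz` is an edge of a kernel of density at most `2 * p`. -/
lemma sum_deg_mul_deg_le (h : IsJumbledKernel A p κ X Y) (hp : 0 ≤ p) (hκ : 0 ≤ κ)
    (hκp : κ ≤ p ^ 2)
    {C : β → γ → ℝ} {Z : Finset γ} (hC : ∀ y, IsIndicator (C y))
    (hCe : ∑ y ∈ Y, ∑ z ∈ Z, C y z ≤ 2 * p * Y.card * Z.card) :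
    ∑ y ∈ Y, (∑ x ∈ X, A x y) * ∑ z ∈ Z, C y z ≤ 4 * p ^ 2 * X.card * Y.card * Z.card := by
  have e : ∑ y ∈ Y, (∑ x ∈ X, A x y) * ∑ z ∈ Z, C y z =
      ∑ z ∈ Z, ∑ x ∈ X, ∑ y ∈ Y, 1 * C y z * A x y := by
    have h1 : ∀ z ∈ Z, ∑ x ∈ X, ∑ y ∈ Y, 1 * C y z * A x y =
        ∑ y ∈ Y, ∑ x ∈ X, 1 * C y z * A x y := fun z _ => Finset.sum_comm
    rw [Finset.sum_congr rfl h1, Finset.sum_comm]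
    refine Finset.sum_congr rfl fun y _ => ?_
    rw [mul_comm, Finset.sum_mul_sum]
    simp only [one_mul]
  rw [e]
  have hCz : ∀ z, IsIndicator fun y => C y z := fun z y => hC y z
  -- For fixed z the neighbourhood of z serves as test set in Y. The error κ|X||Y| is affordable
  -- because κ ≤ p², so no concentration of individual degrees is needed.
  have key : ∀ z ∈ Z, ∑ x ∈ X, ∑ y ∈ Y, 1 * C y z * A x y ≤
      p * X.card * (∑ y ∈ Y, C y z) + κ * X.card * Y.card := by
    intro z _
    have h1 := h.sum_le IsIndicator.one (hCz z)
    have h2 : (X.card : ℝ) * ∑ y ∈ Y, C y z ≤ X.card * Y.card := by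
      gcongr; exact (hCz z).sum_le_card Y
    simp only [Finset.sum_const, nsmul_eq_mul, mul_one] at h1
    nlinarith
  refine (Finset.sum_le_sum key).trans ?_
  rw [Finset.sum_add_distrib, ← Finset.mul_sum, Finset.sum_comm, Finset.sum_const, nsmul_eq_mul]
  have h3 : p * X.card * ∑ y ∈ Y, ∑ z ∈ Z, C y z ≤ p * X.card * (2 * p * Y.card * Z.card) := by
    gcongr
  have h4 : κ * ((X.card : ℝ) * Y.card * Z.card) ≤ p ^ 2 * ((X.card : ℝ) * Y.card * Z.card) := by
    gcongr
  have h5 : 0 ≤ p ^ 2 * ((X.card : ℝ) * Y.card * Z.card) := by positivity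
  nlinarith

end IsJumbledKernel

/-! ### Degrees in a regular subgraph of a jumbled pair. -/

/-- A regular pair in a jumbled one, in terms of `0/1`-valued kernels: `C` is jumbled, `G ≤ C`,
and `G` is close in cut norm to the constant `q * p`. -/
structure IsRegularKernel {β γ : Type*} (C G : β → γ → ℝ) (p q c η : ℝ) (Y : Finset β)
    (Z : Finset γ) : Prop where
  p_pos : 0 < p
  p_le : p ≤ 1
  q_nonneg : 0 ≤ q
  q_le : q ≤ 2
  c_nonneg : 0 ≤ c
  c_le : c ≤ 1
  η_nonneg : 0 ≤ η
  indC : ∀ y, IsIndicator (C y)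
  indG : ∀ y, IsIndicator (G y)
  le : ∀ y z, G y z ≤ C y z
  jumbled : IsJumbledKernel C p (c * p ^ 2) Y Z
  cut : ∀ u v, IsIndicator u → IsIndicator v →
    |∑ y ∈ Y, ∑ z ∈ Z, u y * v z * (G y z - q * p)| ≤ η * p * Y.card * Z.card

namespace IsRegularKernel

variable {β γ : Type*} {C G : β → γ → ℝ} {p q c η : ℝ} {Y : Finset β} {Z : Finset γ}

lemma error_nonneg (h : IsRegularKernel C G p q c η Y Z) : 0 ≤ c * p ^ 2 :=
  mul_nonneg h.c_nonneg (by positivity)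

lemma error_le_sq (h : IsRegularKernel C G p q c η Y Z) : c * p ^ 2 ≤ p ^ 2 := by
  have := h.c_le
  have := sq_nonneg p
  nlinarith

lemma error_le (h : IsRegularKernel C G p q c η Y Z) : c * p ^ 2 ≤ p := by
  have := h.error_le_sq
  have := h.p_pos
  have := h.p_le
  nlinarith

lemma sum_C_le (h : IsRegularKernel C G p q c η Y Z) :
    ∑ y ∈ Y, ∑ z ∈ Z, C y z ≤ 2 * p * Y.card * Z.card :=
  h.jumbled.sum_sum_le h.error_le

lemma sum_G_le (h : IsRegularKernel C G p q c η Y Z) :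
    ∑ y ∈ Y, ∑ z ∈ Z, G y z ≤ 2 * p * Y.card * Z.card :=
  (Finset.sum_le_sum fun y _ => Finset.sum_le_sum fun z _ => h.le y z).trans h.sum_C_le

lemma sum_deg_sq_le (h : IsRegularKernel C G p q c η Y Z) :
    ∑ z ∈ Z, (∑ y ∈ Y, C y z) * (∑ y ∈ Y, C y z) ≤ 4 * p ^ 2 * Y.card ^ 2 * Z.card := by
  have := h.jumbled.sum_deg_mul_deg_le (Z := Y) h.p_pos.le h.error_nonneg h.error_le_sq
    (C := fun z y => C y z) (fun z y => h.indC y z) (by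
      rw [Finset.sum_comm]; linarith [h.sum_C_le])
  linarith

lemma sum_codeg_C_le (h : IsRegularKernel C G p q c η Y Z) :
    ∑ y ∈ Y, ∑ y' ∈ Y, ∑ z ∈ Z, C y z * C y' z ≤ 4 * p ^ 2 * Y.card ^ 2 * Z.card := by
  rw [sum_sum_sum_mul_eq]
  exact h.sum_deg_sq_le

lemma G_mul_le (h : IsRegularKernel C G p q c η Y Z) (y y' : β) (z : γ) :
    G y z * G y' z ≤ C y z * C y' z :=
  mul_le_mul (h.le y z) (h.le y' z) ((h.indG y').nonneg z) ((h.indC y).nonneg z)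

lemma sum_codeg_G_le (h : IsRegularKernel C G p q c η Y Z) :
    ∑ y ∈ Y, ∑ y' ∈ Y, ∑ z ∈ Z, G y z * G y' z ≤ 4 * p ^ 2 * Y.card ^ 2 * Z.card := by
  refine le_trans ?_ h.sum_codeg_C_le
  exact Finset.sum_le_sum fun y _ => Finset.sum_le_sum fun y' _ => Finset.sum_le_sum fun z _ =>
    h.G_mul_le y y' z

lemma sum_abs_deg_sub_le (h : IsRegularKernel C G p q c η Y Z) {s : β → ℝ}
    (hs : IsIndicator s) :
    ∑ z ∈ Z, |∑ y ∈ Y, s y * (G y z - q * p)| ≤ 2 * (η * p * Y.card * Z.card) := by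
  have := sum_mul_abs_le_two_mul Z (f := fun z => ∑ y ∈ Y, s y * (G y z - q * p))
    (M := η * p * Y.card * Z.card) IsIndicator.one ?_
  · simpa using this
  intro v hv _
  have h1 := h.cut s v hs hv
  rw [Finset.sum_comm] at h1
  refine le_of_eq_of_le ?_ h1
  congr 1
  refine Finset.sum_congr rfl fun z _ => ?_
  rw [Finset.mul_sum]
  exact Finset.sum_congr rfl fun y _ => by ring

lemma sum_abs_deg_sub_le' (h : IsRegularKernel C G p q c η Y Z) :
    ∑ y ∈ Y, |∑ z ∈ Z, (G y z - q * p)| ≤ 2 * (η * p * Y.card * Z.card) := by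
  have := sum_mul_abs_le_two_mul Y (f := fun y => ∑ z ∈ Z, (G y z - q * p))
    (M := η * p * Y.card * Z.card) IsIndicator.one ?_
  · simpa using this
  intro v hv _
  refine le_of_eq_of_le ?_ (h.cut v _ hv IsIndicator.one)
  congr 1
  refine Finset.sum_congr rfl fun z _ => ?_
  rw [Finset.mul_sum]
  exact Finset.sum_congr rfl fun y _ => by ring

lemma abs_sub_le (h : IsRegularKernel C G p q c η Y Z) (y : β) (z : γ) :
    |G y z - q * p| ≤ 2 := by
  have h1 := (h.indG y).nonneg z
  have h2 := (h.indG y).le_one z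
  have := h.p_pos
  have := h.p_le
  have := h.q_nonneg
  have := h.q_le
  rw [abs_le]
  constructor <;> nlinarith

/-- An ℓ¹ bound on the deviation D becomes an ℓ² bound because |D| ≤ 3p|Y| up to the deviation of
the degree in C. One factor of D² is estimated in this way; where the deviation appears, the other
factor is bounded trivially by 2|Y|. -/
lemma sum_sq_deg_sub_le (h : IsRegularKernel C G p q c η Y Z) {s : β → ℝ}
    (hs : IsIndicator s) :
    ∑ z ∈ Z, (∑ y ∈ Y, s y * (G y z - q * p)) ^ 2 ≤
      (6 * η + 4 * c) * p ^ 2 * Y.card ^ 2 * Z.card := by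
  have hp := h.p_pos
  have hq := h.q_nonneg
  have key : ∀ z ∈ Z, (∑ y ∈ Y, s y * (G y z - q * p)) ^ 2 ≤
      3 * p * Y.card * |∑ y ∈ Y, s y * (G y z - q * p)| +
        2 * Y.card * |∑ y ∈ Y, (C y z - p)| := by
    intro z _
    set D := ∑ y ∈ Y, s y * (G y z - q * p)
    have h1 : |D| ≤ 2 * Y.card := by
      refine (Finset.abs_sum_le_sum_abs _ _).trans ?_
      have : ∀ y ∈ Y, |s y * (G y z - q * p)| ≤ 2 := by
        intro y _
        rw [abs_mul, abs_of_nonneg (hs.nonneg y)]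
        have := h.abs_sub_le y z
        nlinarith [hs.nonneg y, hs.le_one y, abs_nonneg (G y z - q * p)]
      simpa [mul_comm] using Finset.sum_le_sum this
    have h2 : |D| ≤ 3 * p * Y.card + |∑ y ∈ Y, (C y z - p)| := by
      refine (Finset.abs_sum_le_sum_abs _ _).trans ?_
      have : ∀ y ∈ Y, |s y * (G y z - q * p)| ≤ 3 * p + (C y z - p) := by
        intro y _
        rw [abs_mul, abs_of_nonneg (hs.nonneg y)]
        have h3 : |G y z - q * p| ≤ G y z + q * p := by
          rw [abs_le]
          constructor <;> nlinarith [(h.indG y).nonneg z, mul_nonneg hq hp.le]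
        have h4 := h.le y z
        have h5 := mul_le_mul_of_nonneg_right h.q_le hp.le
        nlinarith [hs.nonneg y, hs.le_one y, abs_nonneg (G y z - q * p)]
      refine (Finset.sum_le_sum this).trans ?_
      rw [Finset.sum_add_distrib, Finset.sum_const, nsmul_eq_mul]
      linarith [le_abs_self (∑ y ∈ Y, (C y z - p))]
    have h3 := abs_nonneg D
    have h4 := abs_nonneg (∑ y ∈ Y, (C y z - p))
    rw [← sq_abs]
    nlinarith
  refine (Finset.sum_le_sum key).trans ?_
  rw [Finset.sum_add_distrib, ← Finset.mul_sum, ← Finset.mul_sum]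
  have h1 := h.sum_abs_deg_sub_le hs
  have h2 := h.jumbled.swap.sum_abs_le h.error_nonneg
  have h3 := mul_le_mul_of_nonneg_left h1 (show 0 ≤ 3 * p * (Y.card : ℝ) by positivity)
  have h4 := mul_le_mul_of_nonneg_left h2 (show 0 ≤ 2 * (Y.card : ℝ) by positivity)
  linarith

end IsRegularKernel

/-! ### Codegrees in a regular pair. -/

namespace IsRegularKernel

variable {β γ : Type*} {C G : β → γ → ℝ} {p q c η : ℝ} {Y : Finset β} {Z : Finset γ}

/-- Replacing one edge of a four-cycle by the constant `p` costs little. -/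
lemma sum_sub_mul_sq_le (h : IsRegularKernel C G p q c η Y Z) {s : β → β → ℝ}
    (hs : ∀ y, IsIndicator (s y)) :
    ∑ y' ∈ Y, ∑ z ∈ Z, (C y' z - p) * (∑ y ∈ Y, s y y' * (G y z - q * p)) ^ 2 ≤
      11 * c * p ^ 3 * Y.card ^ 3 * Z.card := by
  have hp := h.p_pos
  have hp1 := h.p_le
  have hc := h.c_nonneg
  have hq := h.q_nonneg
  set T : β → β → (γ → ℝ) → ℝ := fun y₁ y₂ v =>
    ∑ y' ∈ Y, ∑ z ∈ Z, s y₁ y' * s y₂ y' * v z * (C y' z - p) with hT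
  have T_le : ∀ y₁ y₂ v, IsIndicator v → ∀ t : ℝ, 0 < t → |T y₁ y₂ v| ≤
      c * p ^ 2 / 2 * (t * Z.card * Y.card + Y.card * (∑ z ∈ Z, v z) / t) := by
    intro y₁ y₂ v hv t ht
    refine (h.jumbled _ v ((hs y₁).mul (hs y₂)) hv t ht).trans ?_
    have := h.error_nonneg
    gcongr
    exact ((hs y₁).mul (hs y₂)).sum_le_card Y
  have T_le_one : ∀ y₁ y₂ v, IsIndicator v → |T y₁ y₂ v| ≤ c * p ^ 2 * Y.card * Z.card := by
    intro y₁ y₂ v hv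
    have h1 := T_le y₁ y₂ v hv 1 one_pos
    have h2 := mul_le_mul_of_nonneg_left (hv.sum_le_card Z)
      (show 0 ≤ c * p ^ 2 * Y.card by positivity)
    simp only [one_mul, div_one] at h1
    linarith
  have e : ∑ y' ∈ Y, ∑ z ∈ Z, (C y' z - p) * (∑ y ∈ Y, s y y' * (G y z - q * p)) ^ 2 =
      ∑ y₁ ∈ Y, ∑ y₂ ∈ Y, (T y₁ y₂ (fun z => G y₁ z * G y₂ z) - q * p * T y₁ y₂ (G y₁) -
        q * p * T y₁ y₂ (G y₂) + (q * p) ^ 2 * T y₁ y₂ (fun _ => 1)) := by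
    have e1 : ∀ y' ∈ Y, ∑ z ∈ Z, (C y' z - p) * (∑ y ∈ Y, s y y' * (G y z - q * p)) ^ 2 =
        ∑ y₁ ∈ Y, ∑ y₂ ∈ Y, ∑ z ∈ Z, (C y' z - p) *
          (s y₁ y' * (G y₁ z - q * p) * (s y₂ y' * (G y₂ z - q * p))) := by
      intro y' _
      simp only [sq, Finset.sum_mul_sum]
      simp only [Finset.mul_sum]
      rw [Finset.sum_comm]
      exact Finset.sum_congr rfl fun y _ => Finset.sum_comm
    rw [Finset.sum_congr rfl e1, Finset.sum_comm]
    refine Finset.sum_congr rfl fun y₁ _ => ?_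
    rw [Finset.sum_comm]
    refine Finset.sum_congr rfl fun y₂ _ => ?_
    simp only [hT, Finset.mul_sum, ← Finset.sum_sub_distrib, ← Finset.sum_add_distrib]
    exact Finset.sum_congr rfl fun y' _ => Finset.sum_congr rfl fun z _ => by ring
  rw [e]
  have key : ∀ y₁ ∈ Y, ∀ y₂ ∈ Y, T y₁ y₂ (fun z => G y₁ z * G y₂ z) - q * p * T y₁ y₂ (G y₁) -
        q * p * T y₁ y₂ (G y₂) + (q * p) ^ 2 * T y₁ y₂ (fun _ => 1) ≤
      c * p / 2 * Y.card * (∑ z ∈ Z, G y₁ z * G y₂ z) +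
        17 / 2 * c * p ^ 3 * Y.card * Z.card := by
    intro y₁ _ y₂ _
    -- The common neighbourhood of y₁ and y₂ has on average order p²|Z| elements, so t = p balances
    -- the two error terms and gains a factor p over t = 1. The other three terms already carry a
    -- factor q * p, and t = 1 is enough for them.
    have h1 := (abs_le.1 (T_le y₁ y₂ _ ((h.indG y₁).mul (h.indG y₂)) p hp)).2
    have h2 := (abs_le.1 (T_le_one y₁ y₂ _ (h.indG y₁))).1
    have h3 := (abs_le.1 (T_le_one y₁ y₂ _ (h.indG y₂))).1
    have h4 := (abs_le.1 (T_le_one y₁ y₂ _ IsIndicator.one)).2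
    have hqp : q * p ≤ 2 * p := mul_le_mul_of_nonneg_right h.q_le hp.le
    have hqp0 : 0 ≤ q * p := by positivity
    have hM : 0 ≤ c * p ^ 2 * Y.card * Z.card := by positivity
    have h5 : -(q * p * T y₁ y₂ (G y₁)) ≤ 2 * p * (c * p ^ 2 * Y.card * Z.card) := by nlinarith
    have h6 : -(q * p * T y₁ y₂ (G y₂)) ≤ 2 * p * (c * p ^ 2 * Y.card * Z.card) := by nlinarith
    have h7 : (q * p) ^ 2 * T y₁ y₂ (fun _ => 1) ≤ 4 * p * (c * p ^ 2 * Y.card * Z.card) := by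
      have : (q * p) ^ 2 ≤ 4 * p := by nlinarith
      have := sq_nonneg (q * p)
      nlinarith
    have h8 : c * p ^ 2 / 2 * (p * Z.card * Y.card +
        Y.card * (∑ z ∈ Z, G y₁ z * G y₂ z) / p) =
        c * p ^ 3 / 2 * Y.card * Z.card + c * p / 2 * Y.card * (∑ z ∈ Z, G y₁ z * G y₂ z) := by
      field_simp
    rw [h8] at h1
    linarith
  refine (Finset.sum_le_sum fun y₁ h₁ => Finset.sum_le_sum fun y₂ h₂ => key y₁ h₁ y₂ h₂).trans ?_
  simp only [Finset.sum_add_distrib, ← Finset.mul_sum, Finset.sum_const, nsmul_eq_mul]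
  have h1 := mul_le_mul_of_nonneg_left h.sum_codeg_G_le
    (show 0 ≤ c * p / 2 * Y.card by positivity)
  have h2 : 0 ≤ c * p ^ 3 * Y.card ^ 3 * Z.card := by positivity
  linarith

/-- In a regular pair, few pairs of vertices have codegree exceeding `q ^ 2 * p ^ 2 * Z.card`
substantially. -/
lemma sum_indicator_mul_codeg_sub_le (h : IsRegularKernel C G p q c η Y Z) {τ : ℝ} (hτ : 0 < τ)
    (hτ1 : τ ≤ 1) (hη : η ≤ τ ^ 2) (hc : c ≤ τ ^ 2) {s : β → β → ℝ}
    (hs : ∀ y, IsIndicator (s y)) (hY : 0 < Y.card) :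
    ∑ y ∈ Y, ∑ y' ∈ Y, s y y' * ((∑ z ∈ Z, G y z * G y' z) - q ^ 2 * p ^ 2 * Z.card) ≤
      16 * τ * p ^ 2 * Y.card ^ 2 * Z.card := by
  have hp := h.p_pos
  have hq := h.q_nonneg
  have hn : (0 : ℝ) < Y.card := by exact_mod_cast hY
  have hqp : q * p ≤ 2 * p := mul_le_mul_of_nonneg_right h.q_le hp.le
  set Q : β → γ → ℝ := fun y' z => ∑ y ∈ Y, s y y' * (G y z - q * p) with hQ
  -- With g = G y z and g' = G y' z, this is g g' - (qp)² = g'(g - qp) + qp(g' - qp), summed against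
  -- s.
  have e : ∑ y ∈ Y, ∑ y' ∈ Y, s y y' * ((∑ z ∈ Z, G y z * G y' z) - q ^ 2 * p ^ 2 * Z.card) =
      ∑ y' ∈ Y, ∑ z ∈ Z, G y' z * Q y' z +
        ∑ y' ∈ Y, (q * p) * (∑ y ∈ Y, s y y') * ∑ z ∈ Z, (G y' z - q * p) := by
    rw [Finset.sum_comm, ← Finset.sum_add_distrib]
    refine Finset.sum_congr rfl fun y' _ => ?_
    simp only [hQ, Finset.mul_sum, Finset.sum_mul]
    rw [Finset.sum_comm (s := Z) (t := Y), Finset.sum_comm (s := Z) (t := Y),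
      ← Finset.sum_add_distrib]
    refine Finset.sum_congr rfl fun y _ => ?_
    rw [← Finset.sum_add_distrib, mul_sub, Finset.mul_sum,
      show q ^ 2 * p ^ 2 * (Z.card : ℝ) = ∑ z ∈ Z, q ^ 2 * p ^ 2 by simp [mul_comm],
      Finset.mul_sum, ← Finset.sum_sub_distrib]
    exact Finset.sum_congr rfl fun z _ => by ring
  have b2 : ∑ y' ∈ Y, (q * p) * (∑ y ∈ Y, s y y') * ∑ z ∈ Z, (G y' z - q * p) ≤
      4 * η * p ^ 2 * Y.card ^ 2 * Z.card := by
    have h1 : ∀ y' ∈ Y, (q * p) * (∑ y ∈ Y, s y y') * ∑ z ∈ Z, (G y' z - q * p) ≤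
        2 * p * Y.card * |∑ z ∈ Z, (G y' z - q * p)| := by
      intro y' _
      have hsy : IsIndicator fun y => s y y' := fun y => hs y y'
      refine (mul_le_mul_of_nonneg_left (le_abs_self _)
        (mul_nonneg (by positivity) (hsy.sum_nonneg Y))).trans ?_
      exact mul_le_mul_of_nonneg_right (mul_le_mul hqp (hsy.sum_le_card Y) (hsy.sum_nonneg Y)
        (by positivity)) (abs_nonneg _)
    refine (Finset.sum_le_sum h1).trans ?_
    rw [← Finset.mul_sum]
    have := mul_le_mul_of_nonneg_left h.sum_abs_deg_sub_le'
      (show 0 ≤ 2 * p * (Y.card : ℝ) by positivity)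
    linarith
  -- Writing C = (C - p) + p leaves a jumbledness error 11c and a regularity error 6η + 4c; both η
  -- and c are at most τ², whence 21.
  have b3 : ∑ y' ∈ Y, ∑ z ∈ Z, C y' z * Q y' z ^ 2 ≤
      21 * τ ^ 2 * p ^ 3 * Y.card ^ 3 * Z.card := by
    have h1 := h.sum_sub_mul_sq_le hs
    have h2 : ∑ y' ∈ Y, ∑ z ∈ Z, Q y' z ^ 2 ≤
        Y.card * ((6 * η + 4 * c) * p ^ 2 * Y.card ^ 2 * Z.card) := by
      rw [← nsmul_eq_mul, ← Finset.sum_const]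
      exact Finset.sum_le_sum fun y' _ => h.sum_sq_deg_sub_le (fun y => hs y y')
    have h3 : ∑ y' ∈ Y, ∑ z ∈ Z, C y' z * Q y' z ^ 2 =
        ∑ y' ∈ Y, ∑ z ∈ Z, (C y' z - p) * Q y' z ^ 2 + p * ∑ y' ∈ Y, ∑ z ∈ Z, Q y' z ^ 2 := by
      simp only [Finset.mul_sum, ← Finset.sum_add_distrib]
      exact Finset.sum_congr rfl fun y' _ => Finset.sum_congr rfl fun z _ => by ring
    rw [h3]
    have h4 := mul_le_mul_of_nonneg_left h2 hp.le
    have h5 : (6 * η + 15 * c) * (p ^ 3 * Y.card ^ 3 * Z.card) ≤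
        (21 * τ ^ 2) * (p ^ 3 * Y.card ^ 3 * Z.card) := by
      gcongr; linarith
    linarith
  -- Bounding G Q by C |Q| gives a nonnegative weight that no longer involves G. Cauchy–Schwarz is
  -- then used as |Q| ≤ k/2 + Q²/(2k) with k = τp|Y|.
  have b1 : ∑ y' ∈ Y, ∑ z ∈ Z, G y' z * Q y' z ≤
      τ * p * Y.card / 2 * (2 * p * Y.card * Z.card) +
        1 / (2 * τ * p * Y.card) * (21 * τ ^ 2 * p ^ 3 * Y.card ^ 3 * Z.card) := by
    refine le_trans ?_ (add_le_add (mul_le_mul_of_nonneg_left h.sum_C_le (by positivity))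
      (mul_le_mul_of_nonneg_left b3 (by positivity)))
    simp only [Finset.mul_sum, ← Finset.sum_add_distrib]
    gcongr with y' _ z _
    have h1 := (h.indG y').nonneg z
    have h2 := h.le y' z
    have h3 : |Q y' z| ≤ τ * p * Y.card / 2 + 1 / (2 * τ * p * Y.card) * Q y' z ^ 2 := by
      have hk : 0 < τ * p * Y.card := by positivity
      have h4 : τ * p * Y.card / 2 + 1 / (2 * τ * p * Y.card) * Q y' z ^ 2 - |Q y' z| =
          (τ * p * Y.card - |Q y' z|) ^ 2 / (2 * (τ * p * Y.card)) := by
        rw [sub_sq, sq_abs]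
        field_simp
        ring
      have h5 : 0 ≤ (τ * p * Y.card - |Q y' z|) ^ 2 / (2 * (τ * p * Y.card)) := by positivity
      linarith
    calc G y' z * Q y' z ≤ C y' z * |Q y' z| :=
          (mul_le_mul_of_nonneg_left (le_abs_self _) h1).trans
            (mul_le_mul_of_nonneg_right h2 (abs_nonneg _))
      _ ≤ C y' z * (τ * p * Y.card / 2 + 1 / (2 * τ * p * Y.card) * Q y' z ^ 2) :=
          mul_le_mul_of_nonneg_left h3 (h1.trans h2)
      _ = _ := by ring
  rw [e]
  have b4 : 1 / (2 * τ * p * Y.card) * (21 * τ ^ 2 * p ^ 3 * Y.card ^ 3 * Z.card) =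
      21 / 2 * τ * p ^ 2 * Y.card ^ 2 * Z.card := by
    field_simp
  rw [b4] at b1
  have b5 : η * (p ^ 2 * Y.card ^ 2 * Z.card) ≤ τ * (p ^ 2 * Y.card ^ 2 * Z.card) := by
    gcongr; nlinarith
  have b6 : 0 ≤ τ * (p ^ 2 * Y.card ^ 2 * Z.card) := by positivity
  linarith

end IsRegularKernel

/-! ### Averages over x of degrees and codegrees in neighbourhoods. -/

namespace IsRegularKernel

variable {α β γ : Type*} {A : α → β → ℝ} {B : α → γ → ℝ} {C G : β → γ → ℝ} {p q c η τ : ℝ}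
  {X : Finset α} {Y : Finset β} {Z : Finset γ}

/-- The freedom in s is used here: s selects the pairs with nonnegative excess. -/
lemma sum_max_codeg_sub_le (h : IsRegularKernel C G p q c η Y Z) (hτ : 0 < τ)
    (hτ1 : τ ≤ 1) (hη : η ≤ τ ^ 2) (hc : c ≤ τ ^ 2) (hY : 0 < Y.card) :
    ∑ y ∈ Y, ∑ y' ∈ Y, max ((∑ z ∈ Z, G y z * G y' z) - q ^ 2 * p ^ 2 * Z.card) 0 ≤
      16 * τ * p ^ 2 * Y.card ^ 2 * Z.card := by
  classical
  refine le_of_eq_of_le ?_ (h.sum_indicator_mul_codeg_sub_le hτ hτ1 hη hc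
    (s := fun y y' => if 0 ≤ (∑ z ∈ Z, G y z * G y' z) - q ^ 2 * p ^ 2 * Z.card then 1 else 0)
    (fun y => IsIndicator.ite _) hY)
  refine Finset.sum_congr rfl fun y _ => Finset.sum_congr rfl fun y' _ => ?_
  split_ifs with h0
  · rw [max_eq_left h0, one_mul]
  · rw [max_eq_right (not_le.1 h0).le, zero_mul]

lemma sum_deg_mul_deg_le (h : IsRegularKernel C G p q c η Y Z)
    (hA : IsJumbledKernel A p (c * p ^ 2) X Y) :
    ∑ y ∈ Y, (∑ x ∈ X, A x y) * ∑ z ∈ Z, C y z ≤ 4 * p ^ 2 * X.card * Y.card * Z.card :=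
  hA.sum_deg_mul_deg_le h.p_pos.le h.error_nonneg h.error_le_sq h.indC h.sum_C_le

lemma sum_codeg_A_le (h : IsRegularKernel C G p q c η Y Z) (iA : ∀ x, IsIndicator (A x))
    (hA : IsJumbledKernel A p (c * p ^ 2) X Y) :
    ∑ y ∈ Y, ∑ y' ∈ Y, ∑ x ∈ X, A x y * A x y' ≤ 4 * p ^ 2 * X.card * Y.card ^ 2 := by
  have h1 := hA.swap.sum_deg_mul_deg_le h.p_pos.le h.error_nonneg h.error_le_sq iA
    (hA.sum_sum_le h.error_le)
  have h2 := sum_sum_sum_mul_eq Y X (fun y x => A x y)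
  rw [h2]
  linarith

/-- The weight is needed because an excess codegree of G is only bounded pointwise by the codegree
of C. Opening the weight as a sum over z, jumbledness of A is applied, for each y and z, to the
neighbourhood of y in X and that of z in Y. What remains are counts of paths x, y, z, of paths y, z,
y', and of edges. -/
lemma sum_abs_codeg_sub_mul_codeg_le (h : IsRegularKernel C G p q c η Y Z)
    (iA : ∀ x, IsIndicator (A x)) (hA : IsJumbledKernel A p (c * p ^ 2) X Y) :
    ∑ y ∈ Y, ∑ y' ∈ Y, |(∑ x ∈ X, A x y * A x y') - p ^ 2 * X.card| * ∑ z ∈ Z, C y z * C y' z ≤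
      12 * c * p ^ 4 * X.card * Y.card ^ 2 * Z.card := by
  have hp := h.p_pos
  have hc := h.c_nonneg
  have iA' : ∀ y, IsIndicator fun x => A x y := fun y x => iA x y
  have iC' : ∀ z, IsIndicator fun y => C y z := fun z y => h.indC y z
  have e : ∑ y ∈ Y, ∑ y' ∈ Y, |(∑ x ∈ X, A x y * A x y') - p ^ 2 * X.card| *
        ∑ z ∈ Z, C y z * C y' z =
      ∑ z ∈ Z, ∑ y ∈ Y, ∑ y' ∈ Y,
        C y z * C y' z * |(∑ x ∈ X, A x y * A x y') - p ^ 2 * X.card| := by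
    rw [Finset.sum_comm (s := Z)]
    refine Finset.sum_congr rfl fun y _ => ?_
    rw [Finset.sum_comm (s := Z)]
    refine Finset.sum_congr rfl fun y' _ => ?_
    rw [mul_comm, Finset.sum_mul]
  have tri : ∀ y y', |(∑ x ∈ X, A x y * A x y') - p ^ 2 * X.card| ≤
      |∑ x ∈ X, A x y * (A x y' - p)| + p * |∑ x ∈ X, (A x y - p)| := by
    intro y y'
    rw [← abs_of_nonneg hp.le, ← abs_mul, abs_of_nonneg hp.le]
    refine le_of_eq_of_le ?_ (abs_add_le _ _)
    congr 1
    rw [Finset.mul_sum, ← Finset.sum_add_distrib,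
      show p ^ 2 * (X.card : ℝ) = ∑ x ∈ X, p ^ 2 by simp [mul_comm], ← Finset.sum_sub_distrib]
    exact Finset.sum_congr rfl fun x _ => by ring
  have key1 : ∀ z ∈ Z, ∀ y ∈ Y, ∑ y' ∈ Y, C y z * C y' z * |∑ x ∈ X, A x y * (A x y' - p)| ≤
      c * p ^ 2 * (Y.card * ((∑ x ∈ X, A x y) * C y z)) +
        c * p ^ 2 * (X.card * (C y z * ∑ y' ∈ Y, C y' z)) := by
    intro z _ y _
    have h1 := mul_le_mul_of_nonneg_left
      (hA.swap.sum_mul_abs_le h.error_nonneg (iC' z) (iA' y)) ((h.indC y).nonneg z)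
    simp only [mul_assoc] at h1 ⊢
    rw [← Finset.mul_sum]
    linarith
  have key2 : ∀ z ∈ Z, ∑ y ∈ Y, ∑ y' ∈ Y, C y z * C y' z * (p * |∑ x ∈ X, (A x y - p)|) ≤
      2 * c * p ^ 3 * X.card * Y.card * ∑ y ∈ Y, C y z := by
    intro z _
    have h1 := hA.swap.sum_mul_abs_le h.error_nonneg (iC' z) IsIndicator.one
    simp only [one_mul, Finset.sum_const, nsmul_eq_mul, mul_one] at h1
    have h2 := (iC' z).sum_le_card Y
    have h3 := (iC' z).sum_nonneg Y
    have e1 : ∑ y ∈ Y, ∑ y' ∈ Y, C y z * C y' z * (p * |∑ x ∈ X, (A x y - p)|) =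
        p * (∑ y ∈ Y, C y z) * ∑ y ∈ Y, C y z * |∑ x ∈ X, (A x y - p)| := by
      rw [Finset.mul_sum]
      refine Finset.sum_congr rfl fun y _ => ?_
      rw [Finset.mul_sum, Finset.sum_mul]
      exact Finset.sum_congr rfl fun y' _ => by ring
    rw [e1]
    have h4 : ∑ y ∈ Y, C y z * |∑ x ∈ X, (A x y - p)| ≤ 2 * c * p ^ 2 * X.card * Y.card := by
      have := mul_le_mul_of_nonneg_left h2 (show 0 ≤ c * p ^ 2 * X.card by positivity)
      linarith
    have h5 := mul_le_mul_of_nonneg_left h4 (mul_nonneg hp.le h3)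
    linarith
  have P1 : ∑ z ∈ Z, ∑ y ∈ Y, (∑ x ∈ X, A x y) * C y z ≤
      4 * p ^ 2 * X.card * Y.card * Z.card := by
    rw [Finset.sum_comm]
    simpa only [← Finset.mul_sum] using h.sum_deg_mul_deg_le hA
  have P2 : ∑ z ∈ Z, ∑ y ∈ Y, C y z * ∑ y' ∈ Y, C y' z ≤ 4 * p ^ 2 * Y.card ^ 2 * Z.card := by
    simpa only [← Finset.sum_mul] using h.sum_deg_sq_le
  have P3 : ∑ z ∈ Z, ∑ y ∈ Y, C y z ≤ 2 * p * Y.card * Z.card := by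
    rw [Finset.sum_comm]
    exact h.sum_C_le
  rw [e]
  calc ∑ z ∈ Z, ∑ y ∈ Y, ∑ y' ∈ Y,
        C y z * C y' z * |(∑ x ∈ X, A x y * A x y') - p ^ 2 * X.card|
      ≤ ∑ z ∈ Z, ∑ y ∈ Y, ∑ y' ∈ Y, (C y z * C y' z * |∑ x ∈ X, A x y * (A x y' - p)| +
          C y z * C y' z * (p * |∑ x ∈ X, (A x y - p)|)) := by
        refine Finset.sum_le_sum fun z _ => Finset.sum_le_sum fun y _ =>
          Finset.sum_le_sum fun y' _ => ?_
        rw [← mul_add]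
        exact mul_le_mul_of_nonneg_left (tri y y')
          (mul_nonneg ((h.indC y).nonneg z) ((h.indC y').nonneg z))
    _ = ∑ z ∈ Z, ∑ y ∈ Y, ∑ y' ∈ Y, C y z * C y' z * |∑ x ∈ X, A x y * (A x y' - p)| +
          ∑ z ∈ Z, ∑ y ∈ Y, ∑ y' ∈ Y, C y z * C y' z * (p * |∑ x ∈ X, (A x y - p)|) := by
        simp only [Finset.sum_add_distrib]
    _ ≤ ∑ z ∈ Z, ∑ y ∈ Y, (c * p ^ 2 * (Y.card * ((∑ x ∈ X, A x y) * C y z)) +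
          c * p ^ 2 * (X.card * (C y z * ∑ y' ∈ Y, C y' z))) +
          ∑ z ∈ Z, 2 * c * p ^ 3 * X.card * Y.card * ∑ y ∈ Y, C y z :=
        add_le_add (Finset.sum_le_sum fun z hz => Finset.sum_le_sum fun y hy => key1 z hz y hy)
          (Finset.sum_le_sum key2)
    _ = c * p ^ 2 * Y.card * (∑ z ∈ Z, ∑ y ∈ Y, (∑ x ∈ X, A x y) * C y z) +
          c * p ^ 2 * X.card * (∑ z ∈ Z, ∑ y ∈ Y, C y z * ∑ y' ∈ Y, C y' z) +
          2 * c * p ^ 3 * X.card * Y.card * ∑ z ∈ Z, ∑ y ∈ Y, C y z := by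
        simp only [Finset.sum_add_distrib, ← Finset.mul_sum, mul_assoc]
    _ ≤ c * p ^ 2 * Y.card * (4 * p ^ 2 * X.card * Y.card * Z.card) +
          c * p ^ 2 * X.card * (4 * p ^ 2 * Y.card ^ 2 * Z.card) +
          2 * c * p ^ 3 * X.card * Y.card * (2 * p * Y.card * Z.card) := by
        gcongr
    _ = _ := by ring

/-- The codegree of y, y' into X is split into p²|X| and its deviation. The first part meets the
total excess (16τ); the second is weighted by at most the codegree in C (12c ≤ 12τ). -/
lemma sum_sum_max_codeg_sub_le (h : IsRegularKernel C G p q c η Y Z)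
    (iA : ∀ x, IsIndicator (A x)) (hA : IsJumbledKernel A p (c * p ^ 2) X Y) (hτ : 0 < τ)
    (hτ1 : τ ≤ 1) (hη : η ≤ τ ^ 2) (hc : c ≤ τ ^ 2) (hY : 0 < Y.card) :
    ∑ x ∈ X, ∑ y ∈ Y, ∑ y' ∈ Y, A x y * A x y' *
        max ((∑ z ∈ Z, G y z * G y' z) - q ^ 2 * p ^ 2 * Z.card) 0 ≤
      28 * τ * (p ^ 4 * Y.card ^ 2 * Z.card) * X.card := by
  have hp := h.p_pos
  have hc0 := h.c_nonneg
  set H : β → β → ℝ := fun y y' =>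
    max ((∑ z ∈ Z, G y z * G y' z) - q ^ 2 * p ^ 2 * Z.card) 0 with hH
  have H0 : ∀ y y', 0 ≤ H y y' := fun y y' => le_max_right _ _
  have HC : ∀ y y', H y y' ≤ ∑ z ∈ Z, C y z * C y' z := by
    intro y y'
    have h1 := Finset.sum_le_sum fun z (_ : z ∈ Z) => h.G_mul_le y y' z
    have h2 : 0 ≤ q ^ 2 * p ^ 2 * (Z.card : ℝ) := by positivity
    have h3 : 0 ≤ ∑ z ∈ Z, C y z * C y' z := ((h.indC y).mul (h.indC y')).sum_nonneg Z
    exact max_le (by linarith) h3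
  have h1 := h.sum_max_codeg_sub_le hτ hτ1 hη hc hY
  have h2 := h.sum_abs_codeg_sub_mul_codeg_le iA hA
  calc ∑ x ∈ X, ∑ y ∈ Y, ∑ y' ∈ Y, A x y * A x y' * H y y'
      = ∑ y ∈ Y, ∑ y' ∈ Y, (∑ x ∈ X, A x y * A x y') * H y y' := by
        rw [Finset.sum_comm]
        refine Finset.sum_congr rfl fun y _ => ?_
        rw [Finset.sum_comm]
        simp only [Finset.sum_mul]
    _ ≤ ∑ y ∈ Y, ∑ y' ∈ Y, (p ^ 2 * X.card * H y y' +
          |(∑ x ∈ X, A x y * A x y') - p ^ 2 * X.card| * ∑ z ∈ Z, C y z * C y' z) := by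
        refine Finset.sum_le_sum fun y _ => Finset.sum_le_sum fun y' _ => ?_
        have h3 := mul_le_mul_of_nonneg_left (HC y y')
          (abs_nonneg ((∑ x ∈ X, A x y * A x y') - p ^ 2 * X.card))
        have h4 := mul_le_mul_of_nonneg_right
          (le_abs_self ((∑ x ∈ X, A x y * A x y') - p ^ 2 * X.card)) (H0 y y')
        linarith
    _ = p ^ 2 * X.card * ∑ y ∈ Y, ∑ y' ∈ Y, H y y' + ∑ y ∈ Y, ∑ y' ∈ Y,
          |(∑ x ∈ X, A x y * A x y') - p ^ 2 * X.card| * ∑ z ∈ Z, C y z * C y' z := by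
        simp only [Finset.sum_add_distrib, ← Finset.mul_sum]
    _ ≤ p ^ 2 * X.card * (16 * τ * p ^ 2 * Y.card ^ 2 * Z.card) +
          12 * c * p ^ 4 * X.card * Y.card ^ 2 * Z.card := by gcongr
    _ ≤ p ^ 2 * X.card * (16 * τ * p ^ 2 * Y.card ^ 2 * Z.card) +
          12 * τ * p ^ 4 * X.card * Y.card ^ 2 * Z.card := by
        gcongr; nlinarith
    _ = _ := by ring

/-- For each pair y, y' the test sets are its common neighbourhoods in X and in Z, both of average
density at most 4p². With error c p³ this gives exactly the order p⁵ of the main term, which is why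
(X, Z) needs the exponent 3. -/
lemma sum_sum_abs_codeg_le (h : IsRegularKernel C G p q c η Y Z)
    (iA : ∀ x, IsIndicator (A x)) (hA : IsJumbledKernel A p (c * p ^ 2) X Y)
    (hB : IsJumbledKernel B p (c * p ^ 3) X Z) :
    ∑ x ∈ X, ∑ y ∈ Y, ∑ y' ∈ Y, A x y * A x y' *
        |∑ z ∈ Z, G y z * G y' z * (B x z - p)| ≤
      8 * c * (p ^ 5 * Y.card ^ 2 * Z.card) * X.card := by
  have hp := h.p_pos
  have hc := h.c_nonneg
  have iA' : ∀ y, IsIndicator fun x => A x y := fun y x => iA x y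
  have h1 := h.sum_codeg_A_le iA hA
  have h2 := h.sum_codeg_G_le
  calc ∑ x ∈ X, ∑ y ∈ Y, ∑ y' ∈ Y, A x y * A x y' *
        |∑ z ∈ Z, G y z * G y' z * (B x z - p)|
      = ∑ y ∈ Y, ∑ y' ∈ Y, ∑ x ∈ X, A x y * A x y' *
        |∑ z ∈ Z, G y z * G y' z * (B x z - p)| := by
        rw [Finset.sum_comm]
        exact Finset.sum_congr rfl fun y _ => Finset.sum_comm
    _ ≤ ∑ y ∈ Y, ∑ y' ∈ Y, c * p ^ 3 * (Z.card * (∑ x ∈ X, A x y * A x y') +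
          X.card * ∑ z ∈ Z, G y z * G y' z) :=
        Finset.sum_le_sum fun y _ => Finset.sum_le_sum fun y' _ =>
          hB.sum_mul_abs_le (by positivity) ((iA' y).mul (iA' y')) ((h.indG y).mul (h.indG y'))
    _ = c * p ^ 3 * (Z.card * (∑ y ∈ Y, ∑ y' ∈ Y, ∑ x ∈ X, A x y * A x y') +
          X.card * ∑ y ∈ Y, ∑ y' ∈ Y, ∑ z ∈ Z, G y z * G y' z) := by
        simp only [Finset.sum_add_distrib, ← Finset.mul_sum]
    _ ≤ c * p ^ 3 * (Z.card * (4 * p ^ 2 * X.card * Y.card ^ 2) +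
          X.card * (4 * p ^ 2 * Y.card ^ 2 * Z.card)) := by gcongr
    _ = _ := by ring

lemma sum_sum_abs_deg_le (h : IsRegularKernel C G p q c η Y Z)
    (iA : ∀ x, IsIndicator (A x)) (hA : IsJumbledKernel A p (c * p ^ 2) X Y)
    (hB : IsJumbledKernel B p (c * p ^ 3) X Z) :
    ∑ x ∈ X, ∑ y ∈ Y, A x y * |∑ z ∈ Z, G y z * (B x z - p)| ≤
      4 * c * (p ^ 3 * Y.card * Z.card) * X.card := by
  have hp := h.p_pos
  have hp1 := h.p_le
  have hc := h.c_nonneg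
  have h1 := hA.sum_sum_le h.error_le
  have h2 := h.sum_G_le
  calc ∑ x ∈ X, ∑ y ∈ Y, A x y * |∑ z ∈ Z, G y z * (B x z - p)|
      = ∑ y ∈ Y, ∑ x ∈ X, A x y * |∑ z ∈ Z, G y z * (B x z - p)| := Finset.sum_comm
    _ ≤ ∑ y ∈ Y, c * p ^ 3 * (Z.card * (∑ x ∈ X, A x y) + X.card * ∑ z ∈ Z, G y z) :=
        Finset.sum_le_sum fun y _ =>
          hB.sum_mul_abs_le (by positivity) (fun x => iA x y) (h.indG y)
    _ = c * p ^ 3 * (Z.card * (∑ x ∈ X, ∑ y ∈ Y, A x y) +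
          X.card * ∑ y ∈ Y, ∑ z ∈ Z, G y z) := by
        rw [Finset.sum_comm (s := X)]
        simp only [Finset.sum_add_distrib, ← Finset.mul_sum]
    _ ≤ c * p ^ 3 * (Z.card * (2 * p * X.card * Y.card) +
          X.card * (2 * p * Y.card * Z.card)) := by gcongr
    _ = 4 * c * (p ^ 3 * Y.card * Z.card) * X.card * p := by ring
    _ ≤ _ := mul_le_of_le_one_right (by positivity) hp1

/-- Degrees into X are replaced by p|X|, which leaves the ℓ¹ bound coming from regularity. Their
deviation is paired with the trivial bound 2|Z|. -/
lemma sum_sum_abs_deg_sub_le (h : IsRegularKernel C G p q c η Y Z)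
    (hA : IsJumbledKernel A p (c * p ^ 2) X Y) :
    ∑ x ∈ X, ∑ y ∈ Y, A x y * |∑ z ∈ Z, (G y z - q * p)| ≤
      (2 * η + 4 * c) * (p ^ 2 * Y.card * Z.card) * X.card := by
  have hp := h.p_pos
  have hD : ∀ y, |∑ z ∈ Z, (G y z - q * p)| ≤ 2 * Z.card := by
    intro y
    refine (Finset.abs_sum_le_sum_abs _ _).trans ?_
    simpa [mul_comm] using Finset.sum_le_sum fun z (_ : z ∈ Z) => h.abs_sub_le y z
  have h1 := h.sum_abs_deg_sub_le'
  have h2 := hA.swap.sum_abs_le h.error_nonneg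
  calc ∑ x ∈ X, ∑ y ∈ Y, A x y * |∑ z ∈ Z, (G y z - q * p)|
      = ∑ y ∈ Y, (∑ x ∈ X, A x y) * |∑ z ∈ Z, (G y z - q * p)| := by
        rw [Finset.sum_comm]
        simp only [Finset.sum_mul]
    _ ≤ ∑ y ∈ Y, (p * X.card * |∑ z ∈ Z, (G y z - q * p)| +
          2 * Z.card * |∑ x ∈ X, (A x y - p)|) := by
        refine Finset.sum_le_sum fun y _ => ?_
        have h3 := le_abs_self (∑ x ∈ X, (A x y - p))
        have h4 : ∑ x ∈ X, (A x y - p) = ∑ x ∈ X, A x y - p * X.card := by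
          simp [Finset.sum_sub_distrib, mul_comm]
        have h5 : ∑ x ∈ X, A x y ≤ p * X.card + |∑ x ∈ X, (A x y - p)| := by linarith
        have h6 := mul_le_mul_of_nonneg_right h5 (abs_nonneg (∑ z ∈ Z, (G y z - q * p)))
        have h7 := mul_le_mul_of_nonneg_left (hD y) (abs_nonneg (∑ x ∈ X, (A x y - p)))
        linarith
    _ = p * X.card * ∑ y ∈ Y, |∑ z ∈ Z, (G y z - q * p)| +
          2 * Z.card * ∑ y ∈ Y, |∑ x ∈ X, (A x y - p)| := by
        simp only [Finset.sum_add_distrib, ← Finset.mul_sum]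
    _ ≤ p * X.card * (2 * (η * p * Y.card * Z.card)) +
          2 * Z.card * (2 * (c * p ^ 2) * Y.card * X.card) := by gcongr
    _ = _ := by ring

end IsRegularKernel

/-! ### From degrees and codegrees to regularity, for one vertex x. -/

/-- A pair of neighbourhoods (with indicators `a` and `b`) in which degrees and codegrees of `G`
behave as expected inherits the regularity of `G`. -/
lemma sq_sum_mul_sub_le {β γ : Type*} {G : β → γ → ℝ} {p q δ : ℝ} {Y : Finset β} {Z : Finset γ}
    {a u : β → ℝ} {b w : γ → ℝ} (hp : 0 < p) (hq : 0 ≤ q) (hq2 : q ≤ 2)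
    (hδ : δ ≤ 1) (ia : IsIndicator a) (iu : IsIndicator u)
    (iw : IsIndicator w) (hua : ∀ y, u y ≤ a y) (hwb : ∀ z, w z ≤ b z)
    (h1 : ∑ y ∈ Y, ∑ y' ∈ Y, a y * a y' * |∑ z ∈ Z, G y z * G y' z * (b z - p)| ≤
      δ * (p ^ 5 * Y.card ^ 2 * Z.card))
    (h2 : ∑ y ∈ Y, ∑ y' ∈ Y, a y * a y' *
      max ((∑ z ∈ Z, G y z * G y' z) - q ^ 2 * p ^ 2 * Z.card) 0 ≤
        δ * (p ^ 4 * Y.card ^ 2 * Z.card))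
    (h3 : ∑ y ∈ Y, a y * |∑ z ∈ Z, G y z * (b z - p)| ≤ δ * (p ^ 3 * Y.card * Z.card))
    (h4 : ∑ y ∈ Y, a y * |∑ z ∈ Z, (G y z - q * p)| ≤ δ * (p ^ 2 * Y.card * Z.card))
    (h5 : |∑ y ∈ Y, (a y - p)| ≤ δ * (p * Y.card))
    (h6 : |∑ z ∈ Z, (b z - p)| ≤ δ * (p * Z.card)) :
    (∑ y ∈ Y, ∑ z ∈ Z, u y * w z * (G y z - q * p)) ^ 2 ≤
      68 * δ * (p ^ 3 * Y.card * Z.card) ^ 2 := by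
  set U := ∑ y ∈ Y, u y with hU
  set W := ∑ z ∈ Z, b z with hW
  set n : ℝ := (Y.card : ℝ) with hn
  set m : ℝ := (Z.card : ℝ) with hm
  have hn0 : 0 ≤ n := by positivity
  have hm0 : 0 ≤ m := by positivity
  have hU0 : 0 ≤ U := iu.sum_nonneg Y
  have hδp : δ * (p * n) ≤ p * n := mul_le_of_le_one_left (by positivity) hδ
  have hδm : δ * (p * m) ≤ p * m := mul_le_of_le_one_left (by positivity) hδ
  have hU2 : U ≤ 2 * p * n := by
    have e : ∑ y ∈ Y, (a y - p) = ∑ y ∈ Y, a y - p * n := by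
      simp [Finset.sum_sub_distrib, mul_comm, hn]
    rw [e] at h5
    have : U ≤ ∑ y ∈ Y, a y := Finset.sum_le_sum fun y _ => hua y
    linarith [(abs_le.1 h5).2]
  have hW1 : W ≤ p * m + δ * (p * m) := by
    have e : ∑ z ∈ Z, (b z - p) = W - p * m := by
      simp [Finset.sum_sub_distrib, mul_comm, hm, hW]
    rw [e] at h6
    linarith [(abs_le.1 h6).2]
  have hw2 : ∑ z ∈ Z, w z ≤ 2 * p * m := by
    have : ∑ z ∈ Z, w z ≤ W := Finset.sum_le_sum fun z _ => hwb z
    linarith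
  set D : γ → ℝ := fun z => ∑ y ∈ Y, u y * (G y z - q * p) with hD
  have uu : ∀ y y', u y * u y' ≤ a y * a y' := fun y y' =>
    mul_le_mul (hua y) (hua y') (iu.nonneg y') (ia.nonneg y)
  -- Only an upper bound is needed for the quadratic term and, in `T2`, only a lower bound for the
  -- linear one; hence a one-sided codegree condition suffices.
  have T1 : ∑ y ∈ Y, ∑ y' ∈ Y, u y * u y' * ∑ z ∈ Z, b z * G y z * G y' z ≤
      δ * (p ^ 5 * n ^ 2 * m) + p * (δ * (p ^ 4 * n ^ 2 * m)) + q ^ 2 * p ^ 3 * m * U ^ 2 := by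
    have e : q ^ 2 * p ^ 3 * m * U ^ 2 =
        ∑ y ∈ Y, ∑ y' ∈ Y, u y * u y' * (q ^ 2 * p ^ 3 * m) := by
      simp only [← Finset.sum_mul, ← Finset.mul_sum]
      ring
    rw [e]
    refine le_trans ?_ (add_le_add_left (add_le_add h1 (mul_le_mul_of_nonneg_left h2 hp.le)) _)
    simp only [Finset.mul_sum, ← Finset.sum_add_distrib]
    refine Finset.sum_le_sum fun y _ => Finset.sum_le_sum fun y' _ => ?_
    simp only [← Finset.mul_sum]
    set M := ∑ z ∈ Z, G y z * G y' z with hM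
    have e1 : ∑ z ∈ Z, b z * G y z * G y' z = ∑ z ∈ Z, G y z * G y' z * (b z - p) + p * M := by
      rw [hM, Finset.mul_sum, ← Finset.sum_add_distrib]
      exact Finset.sum_congr rfl fun z _ => by ring
    rw [e1]
    have k1 : u y * u y' * ∑ z ∈ Z, G y z * G y' z * (b z - p) ≤
        a y * a y' * |∑ z ∈ Z, G y z * G y' z * (b z - p)| :=
      (mul_le_mul_of_nonneg_left (le_abs_self _) (mul_nonneg (iu.nonneg y) (iu.nonneg y'))).trans
        (mul_le_mul_of_nonneg_right (uu y y') (abs_nonneg _))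
    have k2 : u y * u y' * M ≤ a y * a y' * max (M - q ^ 2 * p ^ 2 * m) 0 +
        u y * u y' * (q ^ 2 * p ^ 2 * m) := by
      have k3 := mul_le_mul_of_nonneg_left (le_max_left (M - q ^ 2 * p ^ 2 * m) 0)
        (mul_nonneg (iu.nonneg y) (iu.nonneg y'))
      have k4 := mul_le_mul_of_nonneg_right (uu y y') (le_max_right (M - q ^ 2 * p ^ 2 * m) 0)
      linarith
    have k5 := mul_le_mul_of_nonneg_left k2 hp.le
    linarith
  have T2 : q * p ^ 2 * m * U - δ * (p ^ 3 * n * m) - p * (δ * (p ^ 2 * n * m)) ≤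
      ∑ y ∈ Y, u y * ∑ z ∈ Z, b z * G y z := by
    have k : ∀ y ∈ Y, q * p ^ 2 * m * u y - a y * |∑ z ∈ Z, G y z * (b z - p)| -
        p * (a y * |∑ z ∈ Z, (G y z - q * p)|) ≤ u y * ∑ z ∈ Z, b z * G y z := by
      intro y _
      have e1 : ∑ z ∈ Z, b z * G y z = ∑ z ∈ Z, G y z * (b z - p) +
          p * ∑ z ∈ Z, (G y z - q * p) + q * p ^ 2 * m := by
        rw [show q * p ^ 2 * m = ∑ z ∈ Z, q * p ^ 2 by simp [mul_comm, hm],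
          Finset.mul_sum, ← Finset.sum_add_distrib, ← Finset.sum_add_distrib]
        exact Finset.sum_congr rfl fun z _ => by ring
      have k1 : ∀ t : ℝ, -(a y * |t|) ≤ u y * t := fun t => by
        have := mul_le_mul_of_nonneg_left (neg_abs_le t) (iu.nonneg y)
        have := mul_le_mul_of_nonneg_right (hua y) (abs_nonneg t)
        linarith
      have k2 := k1 (∑ z ∈ Z, G y z * (b z - p))
      have k3 := mul_le_mul_of_nonneg_left (k1 (∑ z ∈ Z, (G y z - q * p))) hp.le
      rw [e1]
      linarith
    have k' := Finset.sum_le_sum k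
    rw [Finset.sum_sub_distrib, Finset.sum_sub_distrib, ← Finset.mul_sum, ← Finset.mul_sum] at k'
    have h4' := mul_le_mul_of_nonneg_left h4 hp.le
    linarith
  -- The main terms, each a multiple of q²p³mU², occur with coefficients 1, -2, 1 and cancel. The
  -- errors contribute 2 + 16 + 16 = 34.
  have S : ∑ z ∈ Z, b z * D z ^ 2 ≤ 34 * δ * (p ^ 5 * n ^ 2 * m) := by
    have eD : ∀ z, D z = ∑ y ∈ Y, u y * G y z - q * p * U := by
      intro z
      simp only [hD, hU, Finset.mul_sum, ← Finset.sum_sub_distrib]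
      exact Finset.sum_congr rfl fun y _ => by ring
    have e : ∑ z ∈ Z, b z * D z ^ 2 =
        ∑ y ∈ Y, ∑ y' ∈ Y, u y * u y' * (∑ z ∈ Z, b z * G y z * G y' z) -
          2 * (q * p * U) * (∑ y ∈ Y, u y * ∑ z ∈ Z, b z * G y z) + (q * p * U) ^ 2 * W := by
      have e1 : ∑ y ∈ Y, ∑ y' ∈ Y, u y * u y' * (∑ z ∈ Z, b z * G y z * G y' z) =
          ∑ z ∈ Z, b z * (∑ y ∈ Y, u y * G y z) ^ 2 := by
        simp only [sq, Finset.sum_mul_sum]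
        simp only [Finset.mul_sum]
        rw [Finset.sum_comm (s := Z)]
        refine Finset.sum_congr rfl fun y _ => ?_
        rw [Finset.sum_comm (s := Z)]
        exact Finset.sum_congr rfl fun y' _ => Finset.sum_congr rfl fun z _ => by ring
      have e2 : ∑ y ∈ Y, u y * ∑ z ∈ Z, b z * G y z =
          ∑ z ∈ Z, b z * ∑ y ∈ Y, u y * G y z := by
        simp only [Finset.mul_sum]
        rw [Finset.sum_comm]
        exact Finset.sum_congr rfl fun z _ => Finset.sum_congr rfl fun y _ => by ring
      rw [e1, e2, hW, Finset.mul_sum _ _ (2 * (q * p * U)),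
        Finset.mul_sum _ _ ((q * p * U) ^ 2), ← Finset.sum_sub_distrib, ← Finset.sum_add_distrib]
      refine Finset.sum_congr rfl fun z _ => ?_
      rw [eD]
      ring
    rw [e]
    have hK : 0 ≤ q * p * U := by positivity
    have hK2 : q * p * U ≤ 4 * p ^ 2 * n := by
      calc q * p * U ≤ 2 * p * (2 * p * n) := by gcongr
        _ = _ := by ring
    have k1 := mul_le_mul_of_nonneg_left T2 (show 0 ≤ 2 * (q * p * U) by positivity)
    have k2 := mul_le_mul_of_nonneg_left hW1 (sq_nonneg (q * p * U))
    have h30 : 0 ≤ δ * (p ^ 3 * n * m) := le_trans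
      (Finset.sum_nonneg fun y _ => mul_nonneg (ia.nonneg y) (abs_nonneg _)) h3
    have h60 : 0 ≤ δ * (p * m) := le_trans (abs_nonneg _) h6
    have k3 := mul_le_mul_of_nonneg_right hK2 h30
    have k4 : (q * p * U) ^ 2 * (δ * (p * m)) ≤ (4 * p ^ 2 * n) ^ 2 * (δ * (p * m)) := by
      gcongr
    linarith
  have e : ∑ y ∈ Y, ∑ z ∈ Z, u y * w z * (G y z - q * p) = ∑ z ∈ Z, w z * D z := by
    rw [Finset.sum_comm]
    refine Finset.sum_congr rfl fun z _ => ?_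
    rw [hD, Finset.mul_sum]
    exact Finset.sum_congr rfl fun y _ => by ring
  rw [e]
  -- Since w² = w, applying Cauchy–Schwarz to w and wD keeps the factor Σ w ≤ 2pm, so the
  -- neighbourhood size rather than |Z| enters.
  have cs := Finset.sum_mul_sq_le_sq_mul_sq Z w fun z => w z * D z
  have e2 : ∑ z ∈ Z, w z * (w z * D z) = ∑ z ∈ Z, w z * D z :=
    Finset.sum_congr rfl fun z _ => by rw [← mul_assoc, iw.sq_eq]
  have e3 : ∑ z ∈ Z, w z ^ 2 = ∑ z ∈ Z, w z :=
    Finset.sum_congr rfl fun z _ => by rw [sq, iw.sq_eq]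
  have e4 : ∑ z ∈ Z, (w z * D z) ^ 2 ≤ ∑ z ∈ Z, b z * D z ^ 2 := by
    refine Finset.sum_le_sum fun z _ => ?_
    rw [mul_pow, sq (w z), iw.sq_eq]
    exact mul_le_mul_of_nonneg_right (hwb z) (sq_nonneg _)
  rw [e2, e3] at cs
  refine cs.trans ((mul_le_mul hw2 (e4.trans S)
    (Finset.sum_nonneg fun z _ => sq_nonneg _) (by positivity)).trans (le_of_eq ?_))
  ring

/-! ### Markov's inequality and the exceptional vertices. -/

/-- Markov's inequality for a finite family of sums. -/
lemma mul_card_filter_le {α ι : Type*} [Fintype ι] (X : Finset α) {F : ι → α → ℝ} {κ s : ι → ℝ}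
    {δ : ℝ} (hF : ∀ i x, 0 ≤ F i x) (hs : ∀ i, 0 < s i)
    (h : ∀ i, ∑ x ∈ X, F i x ≤ κ i * s i * X.card)
    (P : α → Prop) [DecidablePred P] (hP : ∀ x, (∀ i, F i x ≤ δ * s i) → ¬ P x) :
    δ * (X.filter P).card ≤ (∑ i, κ i) * X.card := by
  have h0 : ∀ x, 0 ≤ ∑ i, F i x / s i := fun x =>
    Finset.sum_nonneg fun i _ => div_nonneg (hF i x) (hs i).le
  have h1 : ∀ x ∈ X.filter P, δ ≤ ∑ i, F i x / s i := by
    intro x hx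
    by_contra! hlt
    refine hP x (fun i => ?_) (Finset.mem_filter.1 hx).2
    rw [← div_le_iff₀ (hs i)]
    exact (Finset.single_le_sum (f := fun i => F i x / s i)
      (fun j _ => div_nonneg (hF j x) (hs j).le) (Finset.mem_univ i)).trans hlt.le
  have h2 := (Finset.sum_le_sum h1).trans
    (Finset.sum_le_sum_of_subset_of_nonneg (Finset.filter_subset P X) fun x _ _ => h0 x)
  rw [Finset.sum_const, nsmul_eq_mul, Finset.sum_comm] at h2
  rw [mul_comm δ, Finset.sum_mul]
  refine h2.trans (Finset.sum_le_sum fun i _ => ?_)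
  rw [← Finset.sum_div, div_le_iff₀ (hs i)]
  linarith [h i]

namespace IsRegularKernel

variable {α β γ : Type*} {A : α → β → ℝ} {B : α → γ → ℝ} {C G : β → γ → ℝ} {p q c η τ : ℝ}
  {X : Finset α} {Y : Finset β} {Z : Finset γ}

/-- A property which fails whenever degrees and codegrees in the neighbourhood of `x` behave as
expected holds for few `x`. -/
lemma mul_card_filter_le (h : IsRegularKernel C G p q c η Y Z)
    (iA : ∀ x, IsIndicator (A x))
    (hA : IsJumbledKernel A p (c * p ^ 2) X Y) (hB : IsJumbledKernel B p (c * p ^ 3) X Z)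
    (hτ : 0 < τ) (hτ1 : τ ≤ 1) (hη : η ≤ τ ^ 2) (hc : c ≤ τ ^ 2)
    (hY : 0 < Y.card) (hZ : 0 < Z.card) {δ : ℝ} (P : α → Prop) [DecidablePred P]
    (hP : ∀ x,
      ∑ y ∈ Y, ∑ y' ∈ Y, A x y * A x y' * |∑ z ∈ Z, G y z * G y' z * (B x z - p)| ≤
        δ * (p ^ 5 * Y.card ^ 2 * Z.card) →
      ∑ y ∈ Y, ∑ y' ∈ Y, A x y * A x y' *
        max ((∑ z ∈ Z, G y z * G y' z) - q ^ 2 * p ^ 2 * Z.card) 0 ≤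
          δ * (p ^ 4 * Y.card ^ 2 * Z.card) →
      ∑ y ∈ Y, A x y * |∑ z ∈ Z, G y z * (B x z - p)| ≤ δ * (p ^ 3 * Y.card * Z.card) →
      ∑ y ∈ Y, A x y * |∑ z ∈ Z, (G y z - q * p)| ≤ δ * (p ^ 2 * Y.card * Z.card) →
      |∑ y ∈ Y, (A x y - p)| ≤ δ * (p * Y.card) →
      |∑ z ∈ Z, (B x z - p)| ≤ δ * (p * Z.card) → ¬ P x) :
    δ * (X.filter P).card ≤ 50 * τ * X.card := by
  have hp := h.p_pos
  have hp1 := h.p_le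
  have hc0 := h.c_nonneg
  have hn : (0 : ℝ) < Y.card := by exact_mod_cast hY
  have hm : (0 : ℝ) < Z.card := by exact_mod_cast hZ
  have hττ : τ ^ 2 ≤ τ := by nlinarith
  have hcτ : c ≤ τ := hc.trans hττ
  have hητ : η ≤ τ := hη.trans hττ
  have b₁ : ∑ x ∈ X, ∑ y ∈ Y, ∑ y' ∈ Y, A x y * A x y' *
      |∑ z ∈ Z, G y z * G y' z * (B x z - p)| ≤
      8 * τ * (p ^ 5 * Y.card ^ 2 * Z.card) * X.card :=
    (h.sum_sum_abs_codeg_le iA hA hB).trans (by gcongr)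
  have b₂ := h.sum_sum_max_codeg_sub_le iA hA hτ hτ1 hη hc hY
  have b₃ : ∑ x ∈ X, ∑ y ∈ Y, A x y * |∑ z ∈ Z, G y z * (B x z - p)| ≤
      4 * τ * (p ^ 3 * Y.card * Z.card) * X.card :=
    (h.sum_sum_abs_deg_le iA hA hB).trans (by gcongr)
  have b₄ : ∑ x ∈ X, ∑ y ∈ Y, A x y * |∑ z ∈ Z, (G y z - q * p)| ≤
      6 * τ * (p ^ 2 * Y.card * Z.card) * X.card :=
    (h.sum_sum_abs_deg_sub_le hA).trans (by gcongr; linarith)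
  have hcp : ∀ k : ℕ, 1 ≤ k → c * p ^ k ≤ τ * p := fun k hk =>
    mul_le_mul hcτ ((pow_le_pow_of_le_one hp.le hp1 hk).trans_eq (pow_one p))
      (by positivity) hτ.le
  have b₅ : ∑ x ∈ X, |∑ y ∈ Y, (A x y - p)| ≤ 2 * τ * (p * Y.card) * X.card :=
    calc _ ≤ 2 * (c * p ^ 2) * X.card * Y.card := hA.sum_abs_le h.error_nonneg
      _ ≤ 2 * (τ * p) * X.card * Y.card := by
        gcongr 2 * ?_ * _ * _
        exact hcp 2 (by norm_num)
      _ = _ := by ring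
  have b₆ : ∑ x ∈ X, |∑ z ∈ Z, (B x z - p)| ≤ 2 * τ * (p * Z.card) * X.card :=
    calc _ ≤ 2 * (c * p ^ 3) * X.card * Z.card := hB.sum_abs_le (by positivity)
      _ ≤ 2 * (τ * p) * X.card * Z.card := by
        gcongr 2 * ?_ * _ * _
        exact hcp 3 (by norm_num)
      _ = _ := by ring
  have key := _root_.mul_card_filter_le X (δ := δ)
    (κ := ![8 * τ, 28 * τ, 4 * τ, 6 * τ, 2 * τ, 2 * τ])
    (s := ![p ^ 5 * Y.card ^ 2 * Z.card, p ^ 4 * Y.card ^ 2 * Z.card, p ^ 3 * Y.card * Z.card,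
      p ^ 2 * Y.card * Z.card, p * Y.card, p * Z.card])
    (F := ![fun x => ∑ y ∈ Y, ∑ y' ∈ Y, A x y * A x y' *
        |∑ z ∈ Z, G y z * G y' z * (B x z - p)|,
      fun x => ∑ y ∈ Y, ∑ y' ∈ Y, A x y * A x y' *
        max ((∑ z ∈ Z, G y z * G y' z) - q ^ 2 * p ^ 2 * Z.card) 0,
      fun x => ∑ y ∈ Y, A x y * |∑ z ∈ Z, G y z * (B x z - p)|,
      fun x => ∑ y ∈ Y, A x y * |∑ z ∈ Z, (G y z - q * p)|,
      fun x => |∑ y ∈ Y, (A x y - p)|, fun x => |∑ z ∈ Z, (B x z - p)|])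
    (by
      have p₁ := fun x y => (iA x).nonneg y
      intro i x
      fin_cases i
      · exact Finset.sum_nonneg fun y _ => Finset.sum_nonneg fun y' _ =>
          mul_nonneg (mul_nonneg (p₁ x y) (p₁ x y')) (abs_nonneg _)
      · exact Finset.sum_nonneg fun y _ => Finset.sum_nonneg fun y' _ =>
          mul_nonneg (mul_nonneg (p₁ x y) (p₁ x y')) (le_max_right _ _)
      · exact Finset.sum_nonneg fun y _ => mul_nonneg (p₁ x y) (abs_nonneg _)
      · exact Finset.sum_nonneg fun y _ => mul_nonneg (p₁ x y) (abs_nonneg _)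
      · exact abs_nonneg _
      · exact abs_nonneg _)
    (by
      intro i
      fin_cases i <;> simp <;> positivity)
    (by
      intro i
      fin_cases i
      exacts [b₁, b₂, b₃, b₄, b₅, b₆])
    P (fun x hx => hP x (hx 0) (hx 1) (hx 2) (hx 3) (hx 4) (hx 5))
  have e : ∑ i, ![8 * τ, 28 * τ, 4 * τ, 6 * τ, 2 * τ, 2 * τ] i = 50 * τ := by
    simp only [Fin.sum_univ_six, Matrix.cons_val]
    ring
  rwa [e] at key

end IsRegularKernel

/-! ### Translation from graphs to kernels. -/

section Graph

variable {V : Type*} {Γ G : SimpleGraph V} {p : ℝ} {X Y Z : Finset V}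

open Classical in
/-- The adjacency kernel of a graph. -/
noncomputable def adjKernel (Γ : SimpleGraph V) (x y : V) : ℝ := if Γ.Adj x y then 1 else 0

lemma isIndicator_adjKernel (Γ : SimpleGraph V) (x : V) : IsIndicator (adjKernel Γ x) := by
  classical
  exact IsIndicator.ite _

lemma adjKernel_mono (h : G ≤ Γ) (x y : V) : adjKernel G x y ≤ adjKernel Γ x y := by
  unfold adjKernel
  split_ifs with h1 h2
  · exact le_rfl
  · exact absurd (h h1) h2
  · exact zero_le_one
  · exact le_rfl

lemma edgesBetween_eq_sum (Γ : SimpleGraph V) (U W : Finset V) :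
    (edgesBetween Γ U W : ℝ) = ∑ x ∈ U, ∑ y ∈ W, adjKernel Γ x y := by
  classical
  unfold edgesBetween adjKernel
  rw [← Finset.sum_product', Finset.sum_boole]
  congr 2

lemma sum_adjKernel_eq_card_nbrIn (Γ : SimpleGraph V) (x : V) (Y : Finset V) :
    ∑ y ∈ Y, adjKernel Γ x y = (nbrIn Γ x Y).card := by
  classical
  unfold adjKernel nbrIn
  rw [Finset.sum_boole]

lemma sum_adjKernel_sub (Γ : SimpleGraph V) (p t : ℝ) (U W : Finset V) :
    ∑ x ∈ U, ∑ y ∈ W, (adjKernel Γ x y - t * p) =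
      edgesBetween Γ U W - t * p * U.card * W.card := by
  rw [edgesBetween_eq_sum]
  simp only [Finset.sum_sub_distrib, Finset.sum_const, nsmul_eq_mul]
  ring

open Classical in
lemma sum_indicator_mul_eq {α β : Type*} (X : Finset α) (Y : Finset β) {u : α → ℝ} {v : β → ℝ}
    (hu : IsIndicator u) (hv : IsIndicator v) (f : α → β → ℝ) :
    ∑ x ∈ X, ∑ y ∈ Y, u x * v y * f x y =
      ∑ x ∈ X.filter (fun x => u x = 1), ∑ y ∈ Y.filter (fun y => v y = 1), f x y := by
  rw [Finset.sum_filter]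
  refine Finset.sum_congr rfl fun x _ => ?_
  rcases hu x with h | h
  · simp [h]
  · simp only [h, if_true, one_mul, Finset.sum_filter]
    refine Finset.sum_congr rfl fun y _ => ?_
    rcases hv y with h' | h' <;> simp [h']

open Classical in
lemma sum_indicator_eq {α : Type*} (X : Finset α) {u : α → ℝ} (hu : IsIndicator u) :
    ∑ x ∈ X, u x = (X.filter (fun x => u x = 1)).card := by
  rw [Finset.card_filter]
  push_cast
  refine Finset.sum_congr rfl fun x _ => ?_
  rcases hu x with h | h <;> simp [h]

/-- The square root is the geometric mean of t|Y||U| and |X||W|/t, hence at most their arithmetic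
mean. -/
lemma IsBijumbled.isJumbledKernel {κ : ℝ} (hκ : 0 ≤ κ)
    (h : IsBijumbled Γ p (κ * Real.sqrt ((X.card : ℝ) * (Y.card : ℝ))) X Y) :
    IsJumbledKernel (adjKernel Γ) p κ X Y := by
  classical
  intro u v hu hv t ht
  rw [sum_indicator_mul_eq X Y hu hv, sum_indicator_eq X hu, sum_indicator_eq Y hv]
  set U := X.filter fun x => u x = 1
  set W := Y.filter fun y => v y = 1
  have e := sum_adjKernel_sub Γ p 1 U W
  simp only [one_mul] at e
  rw [e]
  refine (h U (Finset.filter_subset _ _) W (Finset.filter_subset _ _)).trans ?_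
  rw [mul_assoc, ← Real.sqrt_mul (by positivity)]
  have h1 : √((X.card : ℝ) * Y.card * (U.card * W.card)) ≤
      (t * Y.card * U.card + X.card * W.card / t) / 2 := by
    rw [Real.sqrt_le_left (by positivity)]
    have h2 : (X.card : ℝ) * Y.card * (U.card * W.card) =
        (t * Y.card * U.card) * (X.card * W.card / t) := by field_simp
    rw [h2]
    linarith [sq_nonneg (t * Y.card * U.card - X.card * W.card / t)]
  have h3 := mul_le_mul_of_nonneg_left h1 hκ
  linarith

lemma IsBijumbled.mono {γ γ' : ℝ} (h : IsBijumbled Γ p γ X Y) (hγ : γ ≤ γ') :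
    IsBijumbled Γ p γ' X Y := fun U hU W hW =>
  (h U hU W hW).trans (mul_le_mul_of_nonneg_right hγ (Real.sqrt_nonneg _))

lemma edgesBetween_sub_eq (hp : 0 < p) (q : ℝ) {U W : Finset V} (hU : 0 < U.card)
    (hW : 0 < W.card) :
    (edgesBetween G U W : ℝ) - q * p * U.card * W.card =
      (pDensity G p U W - q) * (p * U.card * W.card) := by
  have : (0 : ℝ) < U.card := by exact_mod_cast hU
  have : (0 : ℝ) < W.card := by exact_mod_cast hW
  unfold pDensity
  field_simp

/-- Regularity controls pairs of large test sets. If one set is small, then |U||W| ≤ ε|Y||Z|, so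
jumbledness of Γ bounds the edges by (ε + c)p|Y||Z|, while the expected number is at most 2εp|Y||Z|.
Both cases fit in 2ε + c. -/
lemma isRegularKernel_adjKernel {c ε : ℝ} (hp : 0 < p) (hp1 : p ≤ 1) (hc : 0 ≤ c) (hc1 : c ≤ 1)
    (hε : 0 < ε) (hGΓ : G ≤ Γ) (hY : 0 < Y.card) (hZ : 0 < Z.card)
    (hjum : IsJumbledKernel (adjKernel Γ) p (c * p ^ 2) Y Z) (hreg : IsSparseRegular G ε p Y Z) :
    IsRegularKernel (adjKernel Γ) (adjKernel G) p (pDensity G p Y Z) c (2 * ε + c) Y Z := by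
  classical
  have hn : (0 : ℝ) < Y.card := by exact_mod_cast hY
  have hm : (0 : ℝ) < Z.card := by exact_mod_cast hZ
  have hcp2 : c * p ^ 2 ≤ c * p := by
    gcongr
    nlinarith
  have hcp : c * p ^ 2 ≤ p := hcp2.trans (mul_le_of_le_one_left hp.le hc1)
  have hle := adjKernel_mono hGΓ
  have hq0 : 0 ≤ pDensity G p Y Z := by unfold pDensity; positivity
  have hq2 : pDensity G p Y Z ≤ 2 := by
    unfold pDensity
    rw [div_le_iff₀ (by positivity), edgesBetween_eq_sum]
    have h1 := hjum.sum_sum_le hcp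
    have h2 : ∑ y ∈ Y, ∑ z ∈ Z, adjKernel G y z ≤ ∑ y ∈ Y, ∑ z ∈ Z, adjKernel Γ y z :=
      Finset.sum_le_sum fun y _ => Finset.sum_le_sum fun z _ => hle y z
    linarith
  refine ⟨hp, hp1, hq0, hq2, hc, hc1, by positivity, isIndicator_adjKernel Γ,
    isIndicator_adjKernel G, hle, hjum, fun u v hu hv => ?_⟩
  have hup : ∑ y ∈ Y, ∑ z ∈ Z, u y * v z * adjKernel Γ y z ≤
      p * (∑ y ∈ Y, u y) * (∑ z ∈ Z, v z) + c * p * Y.card * Z.card := by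
    have h1 := hjum.sum_le hu hv
    have h2 := mul_le_mul_of_nonneg_left (hu.sum_le_card Y) hm.le
    have h3 := mul_le_mul_of_nonneg_left (hv.sum_le_card Z) hn.le
    have h4 : c * p ^ 2 / 2 * (Z.card * ∑ y ∈ Y, u y + Y.card * ∑ z ∈ Z, v z) ≤
        c * p / 2 * (Z.card * Y.card + Y.card * Z.card) := by
      have := hu.sum_nonneg Y
      have := hv.sum_nonneg Z
      gcongr
    linarith
  rw [sum_indicator_mul_eq Y Z hu hv, sum_indicator_eq Y hu, sum_indicator_eq Z hv] at hup
  rw [sum_indicator_mul_eq Y Z hu hv]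
  set U := Y.filter fun x => u x = 1
  set W := Z.filter fun y => v y = 1
  have hUn : (U.card : ℝ) ≤ Y.card := by exact_mod_cast Finset.card_filter_le _ _
  have hWm : (W.card : ℝ) ≤ Z.card := by exact_mod_cast Finset.card_filter_le _ _
  rw [sum_adjKernel_sub]
  by_cases hbig : ε * (Y.card : ℝ) ≤ U.card ∧ ε * (Z.card : ℝ) ≤ W.card
  · have hU : 0 < U.card := by
      have : (0 : ℝ) < U.card := lt_of_lt_of_le (by positivity) hbig.1
      exact_mod_cast this
    have hW : 0 < W.card := by
      have : (0 : ℝ) < W.card := lt_of_lt_of_le (by positivity) hbig.2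
      exact_mod_cast this
    rw [edgesBetween_sub_eq hp _ hU hW, abs_mul,
      abs_of_nonneg (show 0 ≤ p * (U.card : ℝ) * W.card by positivity)]
    have h1 := hreg U (Finset.filter_subset _ _) W (Finset.filter_subset _ _) hbig.1 hbig.2
    calc _ ≤ ε * (p * Y.card * Z.card) := by gcongr
      _ ≤ (2 * ε + c) * (p * Y.card * Z.card) := by gcongr; linarith
      _ = _ := by ring
  · have hUW : (U.card : ℝ) * W.card ≤ ε * (Y.card * Z.card) := by
      rw [not_and_or, not_le, not_le] at hbig
      rcases hbig with h1 | h1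
      · calc (U.card : ℝ) * W.card ≤ (ε * Y.card) * Z.card := by gcongr
          _ = _ := by ring
      · calc (U.card : ℝ) * W.card ≤ Y.card * (ε * Z.card) := by gcongr
          _ = _ := by ring
    have h2 : (edgesBetween G U W : ℝ) ≤ ∑ x ∈ U, ∑ y ∈ W, adjKernel Γ x y := by
      rw [edgesBetween_eq_sum]
      exact Finset.sum_le_sum fun y _ => Finset.sum_le_sum fun z _ => hle y z
    have h3 : (0 : ℝ) ≤ edgesBetween G U W := by positivity
    have h4 := mul_le_mul_of_nonneg_left hUW hp.le
    have h5 : 0 ≤ ε * p * Y.card * Z.card := by positivity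
    have h6 : 0 ≤ c * p * Y.card * Z.card := by positivity
    have h7 : pDensity G p Y Z * (p * (U.card * W.card)) ≤ 2 * (p * (ε * (Y.card * Z.card))) := by
      gcongr
    have h8 : 0 ≤ pDensity G p Y Z * (p * (U.card * W.card)) := by positivity
    rw [abs_le]
    constructor <;> linarith

end Graph

/-! ### Inheritance in the sparse and in the dense range. -/

section Graph

variable {V : Type*} {Γ G : SimpleGraph V} {p : ℝ} {X Y Z : Finset V}

/-- If all large subpairs of `(U, W)` have density close to a fixed `q`, then `(U, W)` is
regular. -/
lemma isSparseRegularWith_of_abs_sub_le {ε ε' d q : ℝ} {U W : Finset V} (hε1 : ε' ≤ 1)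
    (hq : d - ε ≤ q) (hε : ε ≤ ε' / 2)
    (h : ∀ U' ⊆ U, ∀ W' ⊆ W, ε' * (U.card : ℝ) ≤ U'.card → ε' * (W.card : ℝ) ≤ W'.card →
      |pDensity G p U' W' - q| ≤ ε' / 2) :
    IsSparseRegularWith G ε' d p U W := by
  have h0 := h U subset_rfl W subset_rfl (mul_le_of_le_one_left (by positivity) hε1)
    (mul_le_of_le_one_left (by positivity) hε1)
  have h0' := abs_le.1 h0
  refine ⟨fun U' hU' W' hW' hU hW => ?_, by linarith⟩
  have h1 := abs_le.1 (h U' hU' W' hW' hU hW)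
  rw [abs_le]
  constructor <;> linarith

lemma nbrIn_subset (Γ : SimpleGraph V) (x : V) (Y : Finset V) : nbrIn Γ x Y ⊆ Y := by
  classical
  unfold nbrIn
  exact Finset.filter_subset _ _

lemma le_card_nbrIn {δ : ℝ} {x : V} (hp : 0 < p) (hδ : δ ≤ 1 / 2)
    (h : |∑ y ∈ Y, (adjKernel Γ x y - p)| ≤ δ * (p * Y.card)) :
    p * Y.card / 2 ≤ (nbrIn Γ x Y).card := by
  rw [Finset.sum_sub_distrib, sum_adjKernel_eq_card_nbrIn, Finset.sum_const, nsmul_eq_mul] at h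
  have h1 := mul_le_mul_of_nonneg_right hδ (show 0 ≤ p * (Y.card : ℝ) by positivity)
  linarith [(abs_le.1 h).1]

open Classical in
lemma sum_mem_mul_eq {U W : Finset V} (hU : U ⊆ Y) (hW : W ⊆ Z) (f : V → V → ℝ) :
    ∑ y ∈ Y, ∑ z ∈ Z, (if y ∈ U then (1 : ℝ) else 0) * (if z ∈ W then (1 : ℝ) else 0) * f y z =
      ∑ y ∈ U, ∑ z ∈ W, f y z := by
  rw [sum_indicator_mul_eq Y Z (IsIndicator.ite _) (IsIndicator.ite _)]
  have e : ∀ {S T : Finset V}, S ⊆ T →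
      T.filter (fun y => (if y ∈ S then (1 : ℝ) else 0) = 1) = S := by
    intro S T hST
    ext y
    by_cases hy : y ∈ S <;> simp [hy]
    exact hST hy
  rw [e hU, e hW]

lemma ite_mem_le_adjKernel {x : V} {U : Finset V} [DecidablePred fun y => y ∈ U]
    (hU : U ⊆ nbrIn Γ x Y) (y : V) : (if y ∈ U then (1 : ℝ) else 0) ≤ adjKernel Γ x y := by
  classical
  split_ifs with h
  · have : Γ.Adj x y := by simpa [nbrIn] using (Finset.mem_filter.1 (hU h)).2
    simp [adjKernel, this]
  · exact (isIndicator_adjKernel Γ x).nonneg y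

/-- The two-sided inheritance lemma with a bijumbledness assumption on `(Y, Z)` which is stronger
than the usual one when `p` is close to `1`. -/
lemma mul_card_filter_not_isSparseRegularWith_le {ε' d ε c τ ρ : ℝ} (hε' : 0 < ε')
    (hε'1 : ε' ≤ 1) (hp : 0 < p) (hp1 : p ≤ 1) (hτ : 0 < τ) (hτ1 : τ ≤ 1) (hε : 0 < ε)
    (hεε' : ε ≤ ε' / 2) (hc : 0 ≤ c) (hεc : 2 * ε + c ≤ τ ^ 2)
    (hρ : ρ = ε' ^ 3 / 8) (hGΓ : G ≤ Γ) (hY : 0 < Y.card) (hZ : 0 < Z.card)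
    (hXY : IsJumbledKernel (adjKernel Γ) p (c * p ^ 2) X Y)
    (hXZ : IsJumbledKernel (adjKernel Γ) p (c * p ^ 3) X Z)
    (hYZ : IsJumbledKernel (adjKernel Γ) p (c * p ^ 2) Y Z)
    (hreg : IsSparseRegularWith G ε d p Y Z)
    [DecidablePred fun x => ¬ IsSparseRegularWith G ε' d p (nbrIn Γ x Y) (nbrIn Γ x Z)] :
    ρ ^ 2 / 68 * (X.filter (fun x =>
      ¬ IsSparseRegularWith G ε' d p (nbrIn Γ x Y) (nbrIn Γ x Z))).card ≤ 50 * τ * X.card := by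
  classical
  have hn : (0 : ℝ) < Y.card := by exact_mod_cast hY
  have hm : (0 : ℝ) < Z.card := by exact_mod_cast hZ
  have hc1 : c ≤ 1 := by nlinarith
  have hρ0 : 0 < ρ := by rw [hρ]; positivity
  have hρ1 : ρ ≤ 1 := by
    rw [hρ]
    have := pow_le_one₀ (n := 3) hε'.le hε'1
    linarith
  have hδ : ρ ^ 2 / 68 ≤ 1 / 2 := by nlinarith
  have h := isRegularKernel_adjKernel hp hp1 hc hc1 hε hGΓ hY hZ hYZ hreg.1
  refine h.mul_card_filter_le (isIndicator_adjKernel Γ) hXY hXZ hτ hτ1 hεc (by linarith) hY hZ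
    _ fun x h1 h2 h3 h4 h5 h6 => ?_
  rw [not_not]
  refine isSparseRegularWith_of_abs_sub_le hε'1 hreg.2 hεε' fun U hU W hW hUc hWc => ?_
  have hUY : U ⊆ Y := hU.trans (nbrIn_subset Γ x Y)
  have hWZ : W ⊆ Z := hW.trans (nbrIn_subset Γ x Z)
  have key := sq_sum_mul_sub_le hp h.q_nonneg h.q_le (by linarith) (isIndicator_adjKernel Γ x)
    (IsIndicator.ite fun y => y ∈ U) (IsIndicator.ite fun z => z ∈ W)
    (ite_mem_le_adjKernel hU) (ite_mem_le_adjKernel hW) h1 h2 h3 h4 h5 h6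
  rw [sum_mem_mul_eq hUY hWZ, sum_adjKernel_sub] at key
  have hUc' : ε' * (p * Y.card / 2) ≤ U.card :=
    (mul_le_mul_of_nonneg_left (le_card_nbrIn hp hδ h5) hε'.le).trans hUc
  have hWc' : ε' * (p * Z.card / 2) ≤ W.card :=
    (mul_le_mul_of_nonneg_left (le_card_nbrIn hp hδ h6) hε'.le).trans hWc
  have hU0 : (0 : ℝ) < U.card := lt_of_lt_of_le (by positivity) hUc'
  have hW0 : (0 : ℝ) < W.card := lt_of_lt_of_le (by positivity) hWc'
  rw [edgesBetween_sub_eq hp _ (by exact_mod_cast hU0) (by exact_mod_cast hW0)] at key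
  -- With δ = ρ²/68 the bound 68δ is exactly ρ². Since |U||W| is at least (ε'²/4)p²|Y||Z|, the value
  -- ρ = (ε'/2)(ε'²/4) yields a density deviation of at most ε'/2.
  have key2 : |(pDensity G p U W - pDensity G p Y Z) * (p * U.card * W.card)| ≤
      ρ * (p ^ 3 * Y.card * Z.card) := by
    refine abs_le_of_sq_le_sq (key.trans (le_of_eq ?_)) (by positivity)
    ring
  rw [abs_mul, abs_of_pos (show 0 < p * (U.card : ℝ) * W.card by positivity)] at key2
  have hUW : ε' ^ 2 / 4 * (p ^ 3 * Y.card * Z.card) ≤ p * U.card * W.card := by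
    calc _ = p * (ε' * (p * Y.card / 2)) * (ε' * (p * Z.card / 2)) := by ring
      _ ≤ _ := by gcongr
  have key3 : |pDensity G p U W - pDensity G p Y Z| * (ε' ^ 2 / 4) * (p ^ 3 * Y.card * Z.card) ≤
      (ε' / 2) * (ε' ^ 2 / 4) * (p ^ 3 * Y.card * Z.card) := by
    have := mul_le_mul_of_nonneg_left hUW (abs_nonneg (pDensity G p U W - pDensity G p Y Z))
    have e : ρ * (p ^ 3 * Y.card * Z.card) =
      (ε' / 2) * (ε' ^ 2 / 4) * (p ^ 3 * Y.card * Z.card) := by rw [hρ]; ring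
    linarith
  exact le_of_mul_le_mul_right (le_of_mul_le_mul_right key3 (by positivity)) (by positivity)

/-- Two-sided regularity inheritance in the dense case. -/
lemma card_filter_not_isSparseRegularWith_le_of_half_le {ε' d ε c : ℝ} (hε' : 0 < ε')
    (hε'1 : ε' ≤ 1) (hp : 1 / 2 ≤ p) (hp1 : p ≤ 1)
    (hεε' : ε ≤ ε' / 4) (hc : 0 ≤ c) (hcε' : 8 * c ≤ ε') (hY : 0 < Y.card) (hZ : 0 < Z.card)
    (hXY : IsJumbledKernel (adjKernel Γ) p (c * p ^ 2) X Y)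
    (hXZ : IsJumbledKernel (adjKernel Γ) p (c * p ^ 3) X Z)
    (hreg : IsSparseRegularWith G ε d p Y Z)
    [DecidablePred fun x => ¬ IsSparseRegularWith G ε' d p (nbrIn Γ x Y) (nbrIn Γ x Z)] :
    ((X.filter (fun x =>
      ¬ IsSparseRegularWith G ε' d p (nbrIn Γ x Y) (nbrIn Γ x Z))).card : ℝ) ≤ ε' * X.card := by
  have hn : (0 : ℝ) < Y.card := by exact_mod_cast hY
  have hm : (0 : ℝ) < Z.card := by exact_mod_cast hZ
  have hp0 : 0 < p := by linarith
  have hcp : ∀ k : ℕ, 1 ≤ k → c * p ^ k ≤ c * p := fun k hk =>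
    mul_le_mul_of_nonneg_left ((pow_le_pow_of_le_one hp0.le hp1 hk).trans_eq (pow_one p)) hc
  have b₁ : ∑ x ∈ X, |∑ y ∈ Y, (adjKernel Γ x y - p)| ≤ 2 * c * (p * Y.card) * X.card :=
    calc _ ≤ 2 * (c * p ^ 2) * X.card * Y.card := hXY.sum_abs_le (by positivity)
      _ ≤ 2 * (c * p) * X.card * Y.card := by
        gcongr 2 * ?_ * _ * _
        exact hcp 2 (by norm_num)
      _ = _ := by ring
  have b₂ : ∑ x ∈ X, |∑ z ∈ Z, (adjKernel Γ x z - p)| ≤ 2 * c * (p * Z.card) * X.card :=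
    calc _ ≤ 2 * (c * p ^ 3) * X.card * Z.card := hXZ.sum_abs_le (by positivity)
      _ ≤ 2 * (c * p) * X.card * Z.card := by
        gcongr 2 * ?_ * _ * _
        exact hcp 3 (by norm_num)
      _ = _ := by ring
  -- Two conditions of weight 2c at threshold 1/2 leave at most 8c|X| exceptional vertices.
  have key := mul_card_filter_le X (δ := 1 / 2) (κ := fun _ : Fin 2 => 2 * c)
    (s := ![p * Y.card, p * Z.card])
    (F := ![fun x => |∑ y ∈ Y, (adjKernel Γ x y - p)|, fun x => |∑ z ∈ Z, (adjKernel Γ x z - p)|])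
    (by
      intro i x
      fin_cases i <;> exact abs_nonneg _)
    (by
      intro i
      fin_cases i <;> simp <;> positivity)
    (by
      intro i
      fin_cases i
      exacts [b₁, b₂])
    (fun x => ¬ IsSparseRegularWith G ε' d p (nbrIn Γ x Y) (nbrIn Γ x Z)) ?_
  · simp only [Finset.sum_const, Finset.card_univ, Fintype.card_fin, nsmul_eq_mul] at key
    push_cast at key
    have := mul_le_mul_of_nonneg_right hcε' (show (0 : ℝ) ≤ X.card by positivity)
    linarith
  · intro x hx
    rw [not_not]
    have h1 := le_card_nbrIn (Γ := Γ) hp0 le_rfl (hx 0)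
    have h2 := le_card_nbrIn (Γ := Γ) hp0 le_rfl (hx 1)
    -- Here ε'S ≥ ε'pn/2 ≥ ε'n/4 ≥ εn, so large subsets of the neighbourhoods are large in the
    -- original pair.
    have large : ∀ {S T : ℝ} (n : ℝ), 0 ≤ n → p * n / 2 ≤ S → ε' * S ≤ T → ε * n ≤ T := by
      intro S T n hn0 hS hT
      have h3 := mul_le_mul_of_nonneg_left hS hε'.le
      have h4 := mul_le_mul_of_nonneg_right hεε' hn0
      have h5 := mul_le_mul_of_nonneg_right hp (mul_nonneg hε'.le hn0)
      linarith
    refine isSparseRegularWith_of_abs_sub_le hε'1 hreg.2 (by linarith)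
      fun U hU W hW hUc hWc => ?_
    exact (hreg.1 U (hU.trans (nbrIn_subset Γ x Y)) W (hW.trans (nbrIn_subset Γ x Z))
      (large _ hn.le h1 hUc) (large _ hm.le h2 hWc)).trans (by linarith)

end Graph

/-! ### Choice of constants. -/

open Classical in
theorem lemma1p4 (ε' d : ℝ) (hε' : 0 < ε') (hd : 0 < d) :
    ∃ ε c : ℝ, 0 < ε ∧ 0 < c ∧
      ∀ p : ℝ, 0 < p → p < 1 →
      ∀ (V : Type*) (Γ G : SimpleGraph V) (X Y Z : Finset V),
        G ≤ Γ →
        Disjoint X Y → Disjoint X Z → Disjoint Y Z →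
        IsBijumbled Γ p (c * p ^ 2 * Real.sqrt ((X.card : ℝ) * (Y.card : ℝ))) X Y →
        IsBijumbled Γ p (c * p ^ 3 * Real.sqrt ((X.card : ℝ) * (Z.card : ℝ))) X Z →
        IsBijumbled Γ p
          (c * p ^ (5 / 2 : ℝ) * (Real.logb 2 (1 / p)) ^ (-(1 / 2) : ℝ) *
            Real.sqrt ((Y.card : ℝ) * (Z.card : ℝ))) Y Z →
        IsSparseRegularWith G ε d p Y Z →
        ((X.filter (fun x =>
            ¬ IsSparseRegularWith G ε' d p (nbrIn Γ x Y) (nbrIn Γ x Z))).card : ℝ) ≤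
          ε' * (X.card : ℝ) := by
  rcases le_or_gt 1 ε' with h1 | h1
  · refine ⟨1, 1, one_pos, one_pos, fun p _ _ V Γ G X Y Z _ _ _ _ _ _ _ _ => ?_⟩
    have h2 : ((X.filter (fun x =>
        ¬ IsSparseRegularWith G ε' d p (nbrIn Γ x Y) (nbrIn Γ x Z))).card : ℝ) ≤ X.card := by
      exact_mod_cast Finset.card_filter_le _ _
    exact h2.trans (le_mul_of_one_le_left (by positivity) h1)
  obtain ⟨ρ, hρ⟩ : ∃ ρ, ρ = ε' ^ 3 / 8 := ⟨_, rfl⟩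
  have hρ0 : 0 < ρ := by rw [hρ]; positivity
  have hρ1 : ρ ≤ 1 := by
    rw [hρ]
    have := pow_le_one₀ (n := 3) hε'.le h1.le
    linarith
  -- This makes 50τ, the total weight in Markov's inequality, equal to ε' times the threshold ρ²/68.
  obtain ⟨τ, hτ⟩ : ∃ τ, τ = ρ ^ 2 / 68 * ε' / 50 := ⟨_, rfl⟩
  have hτ0 : 0 < τ := by rw [hτ]; positivity
  have hτε' : τ ≤ ε' / 8 := by
    have : ρ ^ 2 * ε' ≤ 1 * ε' := by
      gcongr
      exact pow_le_one₀ hρ0.le hρ1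
    rw [hτ]
    linarith
  have hτ1 : τ ≤ 1 := by linarith
  have hττ : τ ^ 2 ≤ τ := by nlinarith
  -- These values give 2ε + c ≤ τ². The bound ε ≤ d/2 forces positive density, so Y and Z are
  -- nonempty.
  refine ⟨min (τ ^ 2 / 4) (d / 2), τ ^ 2 / 2, lt_min (by positivity) (by positivity),
    by positivity, fun p hp hp1 V Γ G X Y Z hGΓ _ _ _ hXY hXZ hYZ hreg => ?_⟩
  set ε := min (τ ^ 2 / 4) (d / 2) with hε
  have hε0 : 0 < ε := lt_min (by positivity) (by positivity)
  have hετ : ε ≤ τ ^ 2 / 4 := min_le_left _ _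
  have hεd : ε ≤ d / 2 := min_le_right _ _
  have hdens : 0 < pDensity G p Y Z := by linarith [hreg.2]
  have hY : 0 < Y.card := by
    rw [Nat.pos_iff_ne_zero]
    intro h0
    simp [pDensity, h0] at hdens
  have hZ : 0 < Z.card := by
    rw [Nat.pos_iff_ne_zero]
    intro h0
    simp [pDensity, h0] at hdens
  have kXY := hXY.isJumbledKernel (by positivity)
  have kXZ := hXZ.isJumbledKernel (by positivity)
  -- For p ≤ 1/2 the logarithm is at least 1 and its power -1/2 at most 1. As p tends to 1 that
  -- power is unbounded, so the dense case does not use bijumbledness of (Y, Z).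
  rcases le_or_gt p (1 / 2) with hp2 | hp2
  · have hlog : 1 ≤ Real.logb 2 (1 / p) := by
      rw [Real.le_logb_iff_rpow_le one_lt_two (by positivity), Real.rpow_one,
        le_div_iff₀ hp]
      linarith
    have hpow : p ^ (5 / 2 : ℝ) ≤ p ^ 2 := by
      rw [← Real.rpow_natCast]
      exact Real.rpow_le_rpow_of_exponent_ge hp hp1.le (by norm_num)
    have hγ : τ ^ 2 / 2 * p ^ (5 / 2 : ℝ) * (Real.logb 2 (1 / p)) ^ (-(1 / 2) : ℝ) ≤
        τ ^ 2 / 2 * p ^ 2 := by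
      have hl := Real.rpow_le_one_of_one_le_of_nonpos hlog (show (-(1 / 2) : ℝ) ≤ 0 by norm_num)
      exact (mul_le_of_le_one_right (by positivity) hl).trans
        (mul_le_mul_of_nonneg_left hpow (by positivity))
    have kYZ := (hYZ.mono (mul_le_mul_of_nonneg_right hγ (Real.sqrt_nonneg _))).isJumbledKernel
      (by positivity)
    have key := mul_card_filter_not_isSparseRegularWith_le hε' h1.le hp hp1.le hτ0 hτ1 hε0
      (by linarith) (by positivity) (by linarith) hρ hGΓ hY hZ kXY kXZ kYZ hreg
    have e : 50 * τ * X.card = ρ ^ 2 / 68 * (ε' * X.card) := by rw [hτ]; ring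
    rw [e] at key
    exact le_of_mul_le_mul_left key (by positivity)
  · exact card_filter_not_isSparseRegularWith_le_of_half_le hε' h1.le hp2.le hp1.le
      (by linarith) (by positivity) (by linarith) hY hZ kXY kXZ hreg
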